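/- \textbf{Setting.} Let $D,\lambda,T>0$, let $r\ge 1$ be an integer, and put $\alpha=r\lambda/D$, $\alpha_\lambda=2\pi\alpha/\lambda$. Let $\Omega\subseteq[-D/2,D/2]^2$ be a telescope aperture described by its lines: for every $y\in\mathbb R$ the set $\Omega_y\subseteq[-D/2,D/2]$ (the range of the first coordinate on the line at height $y$) and for every $x\in\mathbb R$ the set $\Omega_x\subseteq[-D/2,D/2]$ (the range of the second coordinate on the line at abscissa $x$) is a union of a fixed finite number of (possibly empty) compact intervals whose borders depend measurably on $y$ and $x$ respectively, and $\Omega=\{(x,y): x\in\Omega_y,\ y\in\Omega_x\}$. This includes rectangles $\Omega=\Omega_y\times\Omega_x=[a_y,b_y]\times[a_x,b_x]$ (constant borders) and annuli (whose lines may be split into two intervals). Let $\mathcal X$ denote characteristic functions. Put $k^n:=1$, $l^n:=1$, $k^c(x):=J_0(\alpha_\lambda x)$ with $J_0(x)=\frac1\pi\int_0^\pi\cos(x\sin t)\,dt$, and $$l^c(x,y):=\frac1T\int_{-T/2}^{T/2}\cos[\alpha_\lambda x\sin(2\pi t/T)]\cos[\alpha_\lambda y\cos(2\pi t/T)]\,dt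 .$$ For $m\in\{n,c\}$ (no modulation, circular modulation) and a real-valued $\Phi$ on $\mathbb R^2$ define $$(P^m_x\Phi)(x,y):=\frac1\pi\mathcal X_\Omega(x,y)\ p.v.\!\int_{\Omega_y}\frac{\sin[\Phi(x',y)-\Phi(x,y)]\,k^m(x'-x)}{x'-x}\,dx'$$ $$\qquad+\frac1{\pi^3}\mathcal X_{\Omega_y}(x)\ p.v.\!\int_{\Omega_y}p.v.\!\int_{\Omega_x}p.v.\!\int_{\Omega_x}\frac{\sin[\Phi(x',y')-\Phi(x,y'')]\,l^m(x'-x,y''-y')}{(x'-x)(y'-y)(y''-y)}\,dy''\,dy'\,dx',$$ $$(P^m_y\Phi)(x,y):=\frac1\pi\mathcal X_\Omega(x,y)\ p.v.\!\int_{\Omega_x}\frac{\sin[\Phi(x,y')-\Phi(x,y)]\,k^m(y'-y)}{y'-y}\,dy'$$ $$\qquad+\frac1{\pi^3}\mathcal X_{\Omega_x}(y)\ p.v.\!\int_{\Omega_y}p.v.\!\int_{\Omega_x}p.v.\!\int_{\Omega_y}\frac{\sin[\Phi(x',y')-\Phi(x'',y)]\,l^m(x''-x',y'-y)}{(x'-x)(y'-y)(x''-x)}\,dx''\,dy'\,dx',$$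 where $\Omega_x,\Omega_y$ are the lines belonging to the point $(x,y)$, $p.v.\int_S f(t)\,dt:=\lim_{\delta\to0^+}\int_{S\setminus[c-\delta,c+\delta]}f(t)\,dt$, and the singular point $c$ is $x$ for integrals over $\Omega_y$ and $y$ for integrals over $\Omega_x$. \textbf{Proposition.} For $m\in\{n,c\}$ the pyramid sensor operator $P^m=[P^m_x,P^m_y]$ is well defined as a map from $H^{11/6}(\mathbb R^2)$ to $L_2(\mathbb R^2)$ (componentwise), and in fact to $L_p(\mathbb R^2)$ for every $1\le p<\infty$. That is, for every real-valued $\Phi\in H^{11/6}(\mathbb R^2)$ and every representative of $\Phi$: for almost every $(x,y)$ all principal values in the definition of $P^m_x\Phi$ and $P^m_y\Phi$ exist (in the iterated integrals, the inner ones for almost every value of the outer integration variables); up to null sets, $P^m_x\Phi$ and $P^m_y\Phi$ do not depend on the representative; and $P^m_x\Phi,\ P^m_y\Phi\in L_2(\mathbb R^2)$, indeed $\in L_p(\mathbb R^2)$ for all $1\le p<\infty$. -/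

import Mathlib

open MeasureTheory Filter Topology
open scoped ENNReal SchwartzMap

noncomputable section

namespace PyramidSensor

/-- The plane `ℝ²` with its Euclidean norm; `z 0` is the coordinate `x`, `z 1` the coordinate `y`. -/
abbrev Plane : Type := EuclideanSpace ℝ (Fin 2)

/-- The Sobolev space `H^s(ℝ²)` of real-valued functions: those classes in `L₂(ℝ²)` for which
`(1 + |ξ|²)^{s/2}` times the Fourier transform is again the Fourier transform of an
`L₂`-function. -/
def sobolevH (s : ℝ) : Set (Lp ℝ 2 (volume : Measure Plane)) :=
  {Φ | TemperedDistribution.MemSobolev s 2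
    ((Complex.ofRealCLM.compLp Φ : Lp ℂ 2 (volume : Measure Plane)) : 𝓢'(Plane, ℂ))}

/-- A telescope aperture inside `[-D/2, D/2]²`, given by its single lines. The horizontal line at
height `y` is a finite union of closed intervals `[xLo i y, xHi i y]`, and the vertical line at
abscissa `x` is a finite union of closed intervals `[yLo j x, yHi j x]`; an interval is empty if its
left border exceeds its right border. Constant borders and one interval per line give a rectangle;
two intervals per line describe an annulus, whose lines are split by the central obstruction. -/
structure Aperture (D : ℝ) where
  nx : ℕ
  ny : ℕ
  xLo : Fin nx → ℝ → ℝ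
  xHi : Fin nx → ℝ → ℝ
  yLo : Fin ny → ℝ → ℝ
  yHi : Fin ny → ℝ → ℝ
  measurable_xLo : ∀ i, Measurable (xLo i)
  measurable_xHi : ∀ i, Measurable (xHi i)
  measurable_yLo : ∀ j, Measurable (yLo j)
  measurable_yHi : ∀ j, Measurable (yHi j)
  le_xLo : ∀ i y, -(D / 2) ≤ xLo i y
  xHi_le : ∀ i y, xHi i y ≤ D / 2
  le_yLo : ∀ j x, -(D / 2) ≤ yLo j x
  yHi_le : ∀ j x, yHi j x ≤ D / 2

namespace Aperture

variable {D : ℝ}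

/-- `Ω_y`: the range of the first coordinate on the line at height `y`. -/
def lineY (Ω : Aperture D) (y : ℝ) : Set ℝ := ⋃ i, Set.Icc (Ω.xLo i y) (Ω.xHi i y)

/-- `Ω_x`: the range of the second coordinate on the line at abscissa `x`. -/
def lineX (Ω : Aperture D) (x : ℝ) : Set ℝ := ⋃ j, Set.Icc (Ω.yLo j x) (Ω.yHi j x)

/-- `Ω = Ω_y × Ω_x`. -/
def region (Ω : Aperture D) : Set Plane := {z | z 0 ∈ Ω.lineY (z 1) ∧ z 1 ∈ Ω.lineX (z 0)}

end Aperture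

/-- The truncated integral whose limit for `δ → 0⁺` is the principal value at `c`. -/
def truncIntegral (S : Set ℝ) (c : ℝ) (f : ℝ → ℝ) (δ : ℝ) : ℝ :=
  ∫ t in S \ Set.Icc (c - δ) (c + δ), f t

/-- `p.v. ∫_S f(t) dt` with singularity at `c`. -/
def pvIntegral (S : Set ℝ) (c : ℝ) (f : ℝ → ℝ) : ℝ :=
  limUnder (𝓝[>] (0 : ℝ)) (truncIntegral S c f)

/-- The principal value `p.v. ∫_S f(t) dt` with singularity at `c` exists: all truncated integrals
are proper Lebesgue integrals and they converge. -/
def PVExists (S : Set ℝ) (c : ℝ) (f : ℝ → ℝ) : Prop :=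
  (∀ δ : ℝ, 0 < δ → IntegrableOn f (S \ Set.Icc (c - δ) (c + δ))) ∧
    ∃ L : ℝ, Tendsto (truncIntegral S c f) (𝓝[>] (0 : ℝ)) (𝓝 L)

/-- The modulation parameter `α_λ = 2πα/λ` with `α = rλ/D`. -/
def modulationParameter (r : ℕ) (lam D : ℝ) : ℝ :=
  2 * Real.pi * (r * lam / D) / lam

/-- The zero-order Bessel function of the first kind. -/
def besselJ0 (x : ℝ) : ℝ :=
  1 / Real.pi * ∫ t in (0 : ℝ)..Real.pi, Real.cos (x * Real.sin t)

/-- The regime of the sensor: no modulation or circular modulation. -/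
inductive Modulation
  | none
  | circular

/-- The function `k^n` or `k^c`; `a` is the modulation parameter. -/
def Modulation.k (a : ℝ) : Modulation → ℝ → ℝ
  | .none, _ => 1
  | .circular, x => besselJ0 (a * x)

/-- The function `l^n` or `l^c`; `a` is the modulation parameter and `T` the time period. -/
def Modulation.l (a T : ℝ) : Modulation → ℝ → ℝ → ℝ
  | .none, _, _ => 1
  | .circular, x, y =>
      1 / T * ∫ t in (-(T / 2))..(T / 2),
        Real.cos (a * x * Real.sin (2 * Real.pi * t / T)) *
          Real.cos (a * y * Real.cos (2 * Real.pi * t / T))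

section operators

variable {D : ℝ} (Ω : Aperture D) (k : ℝ → ℝ) (l : ℝ → ℝ → ℝ) (Φ : Plane → ℝ)

/-- Integrand (in `x'`) of the single integral of `P_x`. -/
def singleX (x y x' : ℝ) : ℝ :=
  Real.sin (Φ !₂[x', y] - Φ !₂[x, y]) * k (x' - x) / (x' - x)

/-- Integrand (in `y''`) of the triple integral of `P_x`. -/
def tripleX (x y x' y' y'' : ℝ) : ℝ :=
  Real.sin (Φ !₂[x', y'] - Φ !₂[x, y'']) * l (x' - x) (y'' - y') /
    ((x' - x) * (y' - y) * (y'' - y))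

/-- Inner principal value (over `y''`) of the triple integral of `P_x`. -/
def innerX (x y x' y' : ℝ) : ℝ := pvIntegral (Ω.lineX x) y (tripleX l Φ x y x' y')

/-- Middle principal value (over `y'`) of the triple integral of `P_x`. -/
def middleX (x y x' : ℝ) : ℝ := pvIntegral (Ω.lineX x) y (innerX Ω l Φ x y x')

/-- The operator `P_x`. -/
def pyramidX (z : Plane) : ℝ :=
  1 / Real.pi * Ω.region.indicator 1 z * pvIntegral (Ω.lineY (z 1)) (z 0) (singleX k Φ (z 0) (z 1))
  + 1 / Real.pi ^ 3 * (Ω.lineY (z 1)).indicator 1 (z 0) *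
      pvIntegral (Ω.lineY (z 1)) (z 0) (middleX Ω l Φ (z 0) (z 1))

/-- All principal values in the definition of `P_x Φ` at the point `z` exist; those of the iterated
integral for almost every value of the outer integration variables. -/
def PyramidXExists (z : Plane) : Prop :=
  PVExists (Ω.lineY (z 1)) (z 0) (singleX k Φ (z 0) (z 1)) ∧
  (∀ᵐ x' ∂volume.restrict (Ω.lineY (z 1)), ∀ᵐ y' ∂volume.restrict (Ω.lineX (z 0)),
    PVExists (Ω.lineX (z 0)) (z 1) (tripleX l Φ (z 0) (z 1) x' y')) ∧
  (∀ᵐ x' ∂volume.restrict (Ω.lineY (z 1)),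
    PVExists (Ω.lineX (z 0)) (z 1) (innerX Ω l Φ (z 0) (z 1) x')) ∧
  PVExists (Ω.lineY (z 1)) (z 0) (middleX Ω l Φ (z 0) (z 1))

/-- Integrand (in `y'`) of the single integral of `P_y`. -/
def singleY (x y y' : ℝ) : ℝ :=
  Real.sin (Φ !₂[x, y'] - Φ !₂[x, y]) * k (y' - y) / (y' - y)

/-- Integrand (in `x''`) of the triple integral of `P_y`. -/
def tripleY (x y x' y' x'' : ℝ) : ℝ :=
  Real.sin (Φ !₂[x', y'] - Φ !₂[x'', y]) * l (x'' - x') (y' - y) /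
    ((x' - x) * (y' - y) * (x'' - x))

/-- Inner principal value (over `x''`) of the triple integral of `P_y`. -/
def innerY (x y x' y' : ℝ) : ℝ := pvIntegral (Ω.lineY y) x (tripleY l Φ x y x' y')

/-- Middle principal value (over `y'`) of the triple integral of `P_y`. -/
def middleY (x y x' : ℝ) : ℝ := pvIntegral (Ω.lineX x) y (innerY Ω l Φ x y x')

/-- The operator `P_y`. -/
def pyramidY (z : Plane) : ℝ :=
  1 / Real.pi * Ω.region.indicator 1 z * pvIntegral (Ω.lineX (z 0)) (z 1) (singleY k Φ (z 0) (z 1))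
  + 1 / Real.pi ^ 3 * (Ω.lineX (z 0)).indicator 1 (z 1) *
      pvIntegral (Ω.lineY (z 1)) (z 0) (middleY Ω l Φ (z 0) (z 1))

/-- All principal values in the definition of `P_y Φ` at the point `z` exist; those of the iterated
integral for almost every value of the outer integration variables. -/
def PyramidYExists (z : Plane) : Prop :=
  PVExists (Ω.lineX (z 0)) (z 1) (singleY k Φ (z 0) (z 1)) ∧
  (∀ᵐ x' ∂volume.restrict (Ω.lineY (z 1)), ∀ᵐ y' ∂volume.restrict (Ω.lineX (z 0)),
    PVExists (Ω.lineY (z 1)) (z 0) (tripleY l Φ (z 0) (z 1) x' y')) ∧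
  (∀ᵐ x' ∂volume.restrict (Ω.lineY (z 1)),
    PVExists (Ω.lineX (z 0)) (z 1) (innerY Ω l Φ (z 0) (z 1) x')) ∧
  PVExists (Ω.lineY (z 1)) (z 0) (middleY Ω l Φ (z 0) (z 1))

end operators

end PyramidSensor

end

/-!
The Sobolev embedding gives `Φ ∈ H^{11/6}(ℝ²)` a representative `ψ` that is Hölder continuous of
exponent `1/2` (`exists_hoelder_representative`): `(1 + |ξ|²)^{11/12} Φ̂` is square integrable,
hence `|ξ|^{1/2} Φ̂` is integrable. The kernels `k` and `l` are bounded by one and Lipschitz, so the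
numerators of all integrands are bounded and Hölder continuous in all integration variables jointly,
uniformly in the point `(x, y)`.

Let `c` lie at positive distance `d` from the borders of a bounded union of intervals `S`. The
kernel `1 / (t - c)` is odd, so `p.v. ∫_S f(t) / (t - c) dt` exists for Hölder continuous `f` and equals an
absolutely convergent integral (`HoelderAt.tendsto_truncIntegral`); it is bounded by a multiple of
`d^{-ε} (1 + |c|)^{ε - 1}` for every small `ε > 0` (`HoelderAt.abs_pvIntegral_le`, `kernelMass_le`).
If `f` depends on further variables, interpolation between the two increments shows that the principal
value is again Hölder continuous in them, with half of the exponent (`Hoelder.hoelder_pvIntegral`).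
Three applications handle the triple integrals (`Hoelder.abs_iteratedOuter_le`). The points
excluded lie on finitely many graphs of measurable functions, a null set.

The factor `d^{-ε}` is in `L_p` for small `ε`. The triple integral of `P_x` is not restricted to
bounded `y`, but it contains two integrations with singularity `y` and decays like `|y|^{2(ε - 1)}`,
which is also in `L_p` for all `p ≥ 1`; the same holds for `P_y` with the coordinates interchanged
(`memLp_pyramidX`, `memLp_pyramidY`). Passing from `ψ` to an arbitrary representative changes the
integrands on null sets of almost every line only (`ae_agreeAt`).
-/

/-! ### Sobolev embedding into Hölder spaces -/

open FourierTransform TemperedDistribution in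
/-- An `L₂`-function whose distributional Fourier transform is an integrable function agrees almost
everywhere with the inverse Fourier integral of the latter: by the self-adjointness of the Fourier
integral, both have the same pairing with every test function. -/
theorem MeasureTheory.Lp.ae_eq_fourierInv_of_fourier_eq {E : Type*} [NormedAddCommGroup E]
    [InnerProductSpace ℝ E] [FiniteDimensional ℝ E] [MeasurableSpace E] [BorelSpace E]
    (f : Lp ℂ 2 (volume : Measure E)) (v : Lp ℂ 1 (volume : Measure E))
    (h : 𝓕 (f : 𝓢'(E, ℂ)) = (v : 𝓢'(E, ℂ))) :
    f =ᵐ[volume] 𝓕⁻ (v : E → ℂ) := by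
  have hv : Integrable (v : E → ℂ) := L1.integrable_coeFn v
  have hcont : Continuous (𝓕⁻ (v : E → ℂ)) :=
    VectorFourier.fourierIntegral_continuous Real.continuous_fourierChar
      (by simpa using! continuous_inner.neg) hv
  refine ae_eq_of_integral_contDiff_smul_eq ((Lp.memLp f).locallyIntegrable (by norm_num))
    hcont.locallyIntegrable fun g hg hgs => ?_
  have hg₁ : HasCompactSupport (Complex.ofRealCLM ∘ g) := hgs.comp_left rfl
  have hg₂ : ContDiff ℝ (↑(⊤ : ℕ∞)) (Complex.ofRealCLM ∘ g) :=
    Complex.ofRealCLM.contDiff.comp hg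
  set u : 𝓢(E, ℂ) := hg₁.toSchwartzMap hg₂ with hu
  have h1 : (f : 𝓢'(E, ℂ)) u = (v : 𝓢'(E, ℂ)) (𝓕⁻ u) := by
    rw [← h, TemperedDistribution.fourier_apply, FourierTransform.fourier_fourierInv_eq]
  have h2 : ∫ x, (𝓕⁻ u) x • v x = ∫ x, u x • (𝓕⁻ (v : E → ℂ)) x := by
    have := VectorFourier.integral_fourierIntegral_smul_eq_flip (L := -innerₗ E)
      (μ := volume) (ν := volume) Real.continuous_fourierChar
      (by simpa using! continuous_inner.neg) u.integrable hv
    have hflip : (-innerₗ E).flip = -innerₗ E := by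
      ext a b
      simp [real_inner_comm]
    rw [hflip] at this
    simp only [SchwartzMap.fourierInv_coe]
    exact this
  rw [Lp.toTemperedDistribution_apply, Lp.toTemperedDistribution_apply, h2] at h1
  simpa [hu] using h1

theorem memLp_two_one_add_norm_sq_rpow {E : Type*} [NormedAddCommGroup E]
    [NormedSpace ℝ E] [FiniteDimensional ℝ E] [MeasurableSpace E] [BorelSpace E]
    (μ : Measure E) [μ.IsAddHaarMeasure] {s : ℝ}
    (hs : Module.finrank ℝ E < 2 * s) : MemLp (fun x : E => (1 + ‖x‖ ^ 2) ^ (-s / 2)) 2 μ := by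
  have hc : Continuous (fun x : E => (1 + ‖x‖ ^ 2) ^ (-s / 2)) :=
    Continuous.rpow_const (by fun_prop) (fun x => Or.inl (by positivity))
  rw [memLp_two_iff_integrable_sq hc.aestronglyMeasurable]
  refine (integrable_rpow_neg_one_add_norm_sq hs).congr (Eventually.of_forall fun x => ?_)
  dsimp only
  rw [← Real.rpow_mul_natCast (by positivity)]
  congr 1
  push_cast; ring

theorem Real.norm_fourierChar_sub_le {β : ℝ} (h0 : 0 ≤ β) (h1 : β ≤ 1) (a b : ℝ) :
    ‖(Real.fourierChar a : ℂ) - (Real.fourierChar b : ℂ)‖ ≤ 2 * (2 * Real.pi * |a - b|) ^ β := by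
  have key : ‖(Real.fourierChar a : ℂ) - (Real.fourierChar b : ℂ)‖
      = ‖Complex.exp (Complex.I * (2 * Real.pi * (a - b) : ℝ)) - 1‖ := by
    have : (Real.fourierChar a : ℂ) - (Real.fourierChar b : ℂ)
        = (Real.fourierChar b : ℂ) *
          (Complex.exp (Complex.I * (2 * Real.pi * (a - b) : ℝ)) - 1) := by
      rw [Real.fourierChar_apply, Real.fourierChar_apply, mul_sub, ← Complex.exp_add, mul_one]
      congr 2
      push_cast; ring
    rw [this, norm_mul, Circle.norm_coe, one_mul]
  rw [key]
  have habs : ‖(2 * Real.pi * (a - b) : ℝ)‖ = 2 * Real.pi * |a - b| := by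
    rw [Real.norm_eq_abs, abs_mul, abs_of_pos (by positivity)]
  rcases le_total (2 * Real.pi * |a - b|) 1 with h | h
  · calc _ ≤ 2 * Real.pi * |a - b| := by
          rw [← habs]; exact Real.norm_exp_I_mul_ofReal_sub_one_le
      _ ≤ (2 * Real.pi * |a - b|) ^ β := by
          conv_lhs => rw [← Real.rpow_one (2 * Real.pi * |a - b|)]
          exact Real.rpow_le_rpow_of_exponent_ge_of_imp (by positivity) h h1 (by simp_all)
      _ ≤ _ := by linarith [Real.rpow_nonneg (by positivity : 0 ≤ 2 * Real.pi * |a - b|) β]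
  · calc _ ≤ (1:ℝ) + 1 := by
          refine (norm_sub_le _ _).trans ?_
          rw [mul_comm, Complex.norm_exp_ofReal_mul_I, norm_one]
      _ ≤ _ := by linarith [Real.one_le_rpow h h0]

open FourierTransform TemperedDistribution in
/-- Sobolev embedding into Hölder functions for `p = 2`: if `u` is the `L₂`-function with
`𝓕 f = (1 + |ξ|²)^(-s/2) u`, then `|ξ|^β 𝓕 f` is integrable by the Cauchy–Schwarz inequality, which
bounds the increments of the inverse Fourier integral. -/
theorem TemperedDistribution.MemSobolev.exists_hoelder_representative {E : Type*}
    [NormedAddCommGroup E]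
    [InnerProductSpace ℝ E] [FiniteDimensional ℝ E] [MeasurableSpace E] [BorelSpace E]
    {s β : ℝ} (h0 : 0 ≤ β) (h1 : β ≤ 1) (hs : Module.finrank ℝ E < 2 * (s - β))
    (f : Lp ℂ 2 (volume : Measure E)) (hf : MemSobolev s 2 (f : 𝓢'(E, ℂ))) :
    ∃ (ψ : E → ℂ) (C : ℝ), f =ᵐ[volume] ψ ∧ ∀ z w, ‖ψ z - ψ w‖ ≤ C * ‖z - w‖ ^ β := by
  obtain ⟨u, hu⟩ := memSobolev_iff_exists_smulLeftCLM_fourier.mp hf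
  have hM : MemLp (fun x : E ↦ Complex.ofReal ((1 + ‖x‖ ^ 2) ^ (-s / 2) : ℝ)) 2 :=
    (memLp_two_one_add_norm_sq_rpow volume (s := s) (by linarith)).ofReal
  -- `v` represents the Fourier transform of `f` as an integrable function.
  set v : Lp ℂ 1 (volume : Measure E) := hM.toLp • u with hv
  have hfv : 𝓕 (f : 𝓢'(E, ℂ)) = (v : 𝓢'(E, ℂ)) := by
    rw [hv, MeasureTheory.Lp.toTemperedDistribution_smul_eq]
    · rw [← hu, smulLeftCLM_smulLeftCLM_apply (by fun_prop) (by fun_prop)]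
      convert! (smulLeftCLM_const 1 (𝓕 (f : 𝓢'(E, ℂ)))).symm using 1
      · simp
      · congr
        ext x
        rw [Pi.mul_apply]
        norm_cast
        rw [← Real.rpow_add (by positivity)]
        ring_nf
        simp
    · fun_prop
  have hvae : ∀ᵐ x, v x = ((1 + ‖x‖ ^ 2) ^ (-s / 2) : ℝ) * u x := by
    filter_upwards [Lp.coeFn_lpSMul (r := 1) hM.toLp u, hM.coeFn_toLp] with x h1 h2
    rw [hv, h1, Pi.smul_apply', h2, smul_eq_mul]
  have hvint : Integrable (v : E → ℂ) := L1.integrable_coeFn v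
  have hprod : Integrable (fun x : E => (1 + ‖x‖ ^ 2) ^ (-(s - β) / 2) * ‖u x‖) :=
    (memLp_two_one_add_norm_sq_rpow volume (s := s - β) hs).integrable_mul (Lp.memLp u).norm
  have hbound : ∀ᵐ x, ‖x‖ ^ β * ‖v x‖ ≤ (1 + ‖x‖ ^ 2) ^ (-(s - β) / 2) * ‖u x‖ := by
    filter_upwards [hvae] with x hx
    rw [hx, norm_mul, Complex.norm_real, Real.norm_of_nonneg (by positivity), ← mul_assoc]
    gcongr
    have : ‖x‖ ^ β ≤ (1 + ‖x‖ ^ 2) ^ (β / 2) := by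
      rw [show β / 2 = (1 / 2) * β by ring, Real.rpow_mul (by positivity), ← Real.sqrt_eq_rpow]
      exact Real.rpow_le_rpow (norm_nonneg _) (Real.le_sqrt_of_sq_le (by linarith)) h0
    calc _ ≤ (1 + ‖x‖ ^ 2) ^ (β / 2) * (1 + ‖x‖ ^ 2) ^ (-s / 2) := by gcongr
      _ = _ := by rw [← Real.rpow_add (by positivity)]; congr 1; ring
  have hwint : Integrable (fun x : E => ‖x‖ ^ β * ‖v x‖) := by
    refine hprod.mono' ?_ (hbound.mono fun x hx => ?_)
    · exact ((continuous_norm.rpow_const fun _ => Or.inr h0).aestronglyMeasurable).mul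
        hvint.1.norm
    · rwa [Real.norm_of_nonneg (by positivity)]
  refine ⟨𝓕⁻ (v : E → ℂ), 2 * (2 * Real.pi) ^ β * ∫ x, ‖x‖ ^ β * ‖v x‖,
    Lp.ae_eq_fourierInv_of_fourier_eq f v hfv, fun z w => ?_⟩
  have hi : ∀ z : E, Integrable fun x => Real.fourierChar (inner ℝ x z) • (v x : ℂ) := by
    intro z
    have := (VectorFourier.fourierIntegral_convergent_iff (L := -innerₗ E) (μ := volume)
      Real.continuous_fourierChar (by simpa using! continuous_inner.neg) z).2 hvint
    simpa using this
  rw [Real.fourierInv_eq, Real.fourierInv_eq, ← integral_sub (hi z) (hi w)]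
  have hR : 2 * (2 * Real.pi) ^ β * (∫ x, ‖x‖ ^ β * ‖v x‖) * ‖z - w‖ ^ β
      = ∫ x, 2 * (2 * Real.pi) ^ β * ‖z - w‖ ^ β * (‖x‖ ^ β * ‖v x‖) := by
    rw [integral_const_mul]; ring
  rw [hR]
  refine norm_integral_le_of_norm_le (hwint.const_mul _) (Eventually.of_forall fun x => ?_)
  have hx : (2 * Real.pi * |inner ℝ x z - inner ℝ x w|) ^ β
      ≤ (2 * Real.pi) ^ β * (‖x‖ ^ β * ‖z - w‖ ^ β) := by
    rw [← inner_sub_right, ← Real.mul_rpow (norm_nonneg _) (norm_nonneg _),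
      ← Real.mul_rpow (by positivity) (by positivity)]
    gcongr
    exact abs_real_inner_le_norm x (z - w)
  rw [Circle.smul_def, Circle.smul_def, smul_eq_mul, smul_eq_mul, ← sub_mul, norm_mul,
    ← mul_assoc]
  gcongr
  linarith [Real.norm_fourierChar_sub_le h0 h1 (inner ℝ x z) (inner ℝ x w)]

namespace PyramidSensor

theorem exists_hoelder_representative {Φ : Lp ℝ 2 (volume : Measure Plane)}
    (hΦ : Φ ∈ sobolevH (11 / 6)) :
    ∃ (ψ : Plane → ℝ) (C : ℝ), 0 ≤ C ∧ Φ =ᵐ[volume] ψ ∧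
      ∀ z w, |ψ z - ψ w| ≤ C * ‖z - w‖ ^ (1 / 2 : ℝ) := by
  obtain ⟨ψ, C, hψ, hC⟩ := TemperedDistribution.MemSobolev.exists_hoelder_representative
    (s := 11 / 6) (β := 1 / 2) (by norm_num) (by norm_num)
    (by rw [finrank_euclideanSpace]; norm_num) _ hΦ
  refine ⟨fun z => (ψ z).re, |C|, abs_nonneg C, ?_, fun z w => ?_⟩
  · filter_upwards [hψ, Complex.ofRealCLM.coeFn_compLp Φ] with z h1 h2
    rw [← h1, h2]
    simp
  · rw [← Complex.sub_re]
    refine (Complex.abs_re_le_norm _).trans ((hC z w).trans ?_)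
    gcongr
    exact le_abs_self C

/-! ### The weakly singular kernel -/

theorem integrableOn_abs_rpow {r : ℝ} (hr : -1 < r) (a : ℝ) :
    IntegrableOn (fun u : ℝ => |u| ^ r) (Set.Icc (-a) a) := by
  rcases lt_or_ge a 0 with ha | ha
  · rw [Set.Icc_eq_empty (by linarith)]; exact integrableOn_empty
  have h1 : IntegrableOn (fun u : ℝ => u ^ r) (Set.Ioc 0 a) := by
    have := intervalIntegral.intervalIntegrable_rpow' (a := 0) (b := a) hr
    rwa [intervalIntegrable_iff, Set.uIoc_of_le ha] at this
  have h2 := h1.integrable_indicator measurableSet_Ioc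
  have h3 := h2.add h2.comp_neg
  refine (h3.integrableOn (s := Set.Icc (-a) a)).mono'
    (Measurable.aestronglyMeasurable (by fun_prop)) ?_
  have h0 : ∀ᵐ u : ℝ, u ≠ 0 := Measure.ae_ne volume 0
  filter_upwards [ae_restrict_mem measurableSet_Icc, ae_restrict_of_ae h0] with u hu hu0
  rw [Real.norm_of_nonneg (by positivity)]
  simp only [Pi.add_apply]
  rcases lt_or_gt_of_ne hu0 with h | h
  · rw [Set.indicator_of_notMem (by simp [h.le]), Set.indicator_of_mem
      (by constructor <;> linarith [hu.1]), abs_of_neg h, zero_add]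
  · rw [Set.indicator_of_notMem (s := Set.Ioc 0 a) (a := -u) (by simp [h.le]),
      Set.indicator_of_mem (by exact ⟨h, hu.2⟩), abs_of_pos h, add_zero]

/-- The mass of the kernel `|u|^(ε-1)` on the unit interval around its singularity. -/
noncomputable def localMass (ε : ℝ) : ℝ := ∫ u in Set.Icc (-1 : ℝ) 1, |u| ^ (ε - 1)

theorem localMass_nonneg (ε : ℝ) : 0 ≤ localMass ε :=
  integral_nonneg fun _ => by positivity

/-- The mass on `S` of the weakly singular kernel with singularity at `c`. -/
noncomputable def kernelMass (ε : ℝ) (S : Set ℝ) (c : ℝ) : ℝ := ∫ t in S, |t - c| ^ (ε - 1)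

theorem kernelMass_nonneg (ε : ℝ) (S : Set ℝ) (c : ℝ) : 0 ≤ kernelMass ε S c :=
  integral_nonneg fun _ => by positivity

theorem integrable_localKernel {ε : ℝ} (h0 : 0 < ε) (c : ℝ) :
    Integrable (fun t => (Set.Icc (-1 : ℝ) 1).indicator (fun u => |u| ^ (ε - 1)) (t - c)) :=
  ((integrableOn_abs_rpow (by linarith) 1).integrable_indicator measurableSet_Icc).comp_sub_right c

theorem integral_localKernel (ε c : ℝ) :
    ∫ t, (Set.Icc (-1 : ℝ) 1).indicator (fun u => |u| ^ (ε - 1)) (t - c) = localMass ε := by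
  rw [integral_sub_right_eq_self (fun t => (Set.Icc (-1 : ℝ) 1).indicator
    (fun u => |u| ^ (ε - 1)) t), integral_indicator measurableSet_Icc, localMass]

theorem abs_rpow_le_localKernel_add_one {ε : ℝ} (h1 : ε ≤ 1) (u : ℝ) :
    |u| ^ (ε - 1) ≤ (Set.Icc (-1 : ℝ) 1).indicator (fun u => |u| ^ (ε - 1)) u + 1 := by
  by_cases hu : u ∈ Set.Icc (-1 : ℝ) 1
  · rw [Set.indicator_of_mem hu]; linarith
  · rw [Set.indicator_of_notMem hu, zero_add]
    refine Real.rpow_le_one_of_one_le_of_nonpos ?_ (by linarith)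
    rw [Set.mem_Icc, ← abs_le, not_le] at hu
    exact hu.le

theorem integrableOn_kernel {ε R : ℝ} (h0 : 0 < ε) (h1 : ε ≤ 1) {S : Set ℝ}
    (hS : S ⊆ Set.Icc (-R) R) (c : ℝ) : IntegrableOn (fun t => |t - c| ^ (ε - 1)) S := by
  have hc : IntegrableOn (fun _ : ℝ => (1 : ℝ)) S :=
    (integrableOn_const measure_Icc_lt_top.ne).mono_set hS
  refine (((integrable_localKernel h0 c).integrableOn).add hc).mono'
    (Measurable.aestronglyMeasurable (by fun_prop)) (Eventually.of_forall fun t => ?_)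
  rw [Real.norm_of_nonneg (by positivity)]
  exact abs_rpow_le_localKernel_add_one h1 _

theorem setIntegral_localKernel_add_one_le {ε R : ℝ} (hR : 0 ≤ R) (h0 : 0 < ε) {S : Set ℝ}
    (hS : S ⊆ Set.Icc (-R) R) (c b : ℝ) (hb : 0 ≤ b) :
    ∫ t in S, ((Set.Icc (-1 : ℝ) 1).indicator (fun u => |u| ^ (ε - 1)) (t - c) + b)
      ≤ localMass ε + 2 * R * b := by
  have hc : IntegrableOn (fun _ : ℝ => b) S :=
    (integrableOn_const measure_Icc_lt_top.ne).mono_set hS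
  rw [integral_add (integrable_localKernel h0 c).integrableOn hc]
  gcongr
  · rw [← integral_localKernel ε c]
    exact setIntegral_le_integral (integrable_localKernel h0 c) (Eventually.of_forall fun t =>
      Set.indicator_nonneg (fun u _ => by positivity) _)
  · rw [setIntegral_const, smul_eq_mul]
    gcongr
    calc volume.real S ≤ volume.real (Set.Icc (-R) R) := measureReal_mono hS measure_Icc_lt_top.ne
      _ = 2 * R := by rw [Real.volume_real_Icc_of_le (by linarith)]; ring

/-- The kernel mass decays like `|c|^(ε-1)` as the singularity moves away from the bounded set. -/
theorem kernelMass_le {ε R : ℝ} (hR : 0 ≤ R) (h0 : 0 < ε) (h1 : ε < 1) {S : Set ℝ}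
    (hSm : MeasurableSet S) (hS : S ⊆ Set.Icc (-R) R) (c : ℝ) :
    kernelMass ε S c ≤ (1 + R) * (localMass ε + 4 * R) * (1 + |c|) ^ (ε - 1) := by
  have hpt : ∀ t ∈ S, |t - c| ^ (ε - 1) ≤ (1 + R) * (1 + |c|) ^ (ε - 1) *
      ((Set.Icc (-1 : ℝ) 1).indicator (fun u => |u| ^ (ε - 1)) (t - c) + 2) := by
    intro t ht
    have htR : |t| ≤ R := abs_le.2 (hS ht)
    set u := |t - c| with hu
    have hcu : 1 + |c| ≤ (1 + R) * (1 + u) := by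
      have : |c| ≤ |t| + u := by
        rw [hu]; linarith [abs_sub_abs_le_abs_sub c t, abs_sub_comm c t]
      nlinarith [abs_nonneg (t - c)]
    have hu0 : 0 ≤ u := abs_nonneg _
    -- At `u = 0` the power `0 ^ (ε - 1)` is zero by convention.
    have hprod : (1 + u) ^ (1 - ε) * u ^ (ε - 1) ≤ u ^ (ε - 1) + 1 := by
      rcases hu0.eq_or_lt with h | h
      · rw [← h, Real.zero_rpow (by linarith)]; norm_num
      · calc (1 + u) ^ (1 - ε) * u ^ (ε - 1) ≤ (1 ^ (1 - ε) + u ^ (1 - ε)) * u ^ (ε - 1) := by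
              gcongr
              exact Real.rpow_add_le_add_rpow zero_le_one hu0 (by linarith) (by linarith)
          _ = u ^ (ε - 1) + 1 := by
              rw [Real.one_rpow, add_mul, one_mul, ← Real.rpow_add h]
              simp
    have hloc := abs_rpow_le_localKernel_add_one h1.le (t - c)
    rw [← hu] at hloc
    have hc0 : (0:ℝ) < 1 + |c| := by positivity
    have h2 : (1 + |c|) ^ (1 - ε) * u ^ (ε - 1) ≤ (1 + R) * (u ^ (ε - 1) + 1) := by
      calc (1 + |c|) ^ (1 - ε) * u ^ (ε - 1)
          ≤ ((1 + R) * (1 + u)) ^ (1 - ε) * u ^ (ε - 1) := by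
            gcongr
        _ = (1 + R) ^ (1 - ε) * ((1 + u) ^ (1 - ε) * u ^ (ε - 1)) := by
            rw [Real.mul_rpow (by positivity) (by positivity), mul_assoc]
        _ ≤ (1 + R) ^ (1 : ℝ) * (u ^ (ε - 1) + 1) := by
            gcongr <;> linarith
        _ = _ := by rw [Real.rpow_one]
    calc u ^ (ε - 1) = (1 + |c|) ^ (ε - 1) * ((1 + |c|) ^ (1 - ε) * u ^ (ε - 1)) := by
          rw [← mul_assoc, ← Real.rpow_add hc0]; simp
      _ ≤ (1 + |c|) ^ (ε - 1) * ((1 + R) * (u ^ (ε - 1) + 1)) := by gcongr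
      _ = (1 + R) * (1 + |c|) ^ (ε - 1) * (u ^ (ε - 1) + 1) := by ring
      _ ≤ _ := by
          refine mul_le_mul_of_nonneg_left ?_ (by positivity)
          linarith
  have hc : IntegrableOn (fun _ : ℝ => (2 : ℝ)) S :=
    (integrableOn_const measure_Icc_lt_top.ne).mono_set hS
  calc kernelMass ε S c ≤ ∫ t in S, (1 + R) * (1 + |c|) ^ (ε - 1) *
      ((Set.Icc (-1 : ℝ) 1).indicator (fun u => |u| ^ (ε - 1)) (t - c) + 2) :=
        setIntegral_mono_on (integrableOn_kernel h0 h1.le hS c)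
          (((integrable_localKernel h0 c).integrableOn.add hc).const_mul _) hSm hpt
    _ = (1 + R) * (1 + |c|) ^ (ε - 1) * ∫ t in S,
      ((Set.Icc (-1 : ℝ) 1).indicator (fun u => |u| ^ (ε - 1)) (t - c) + 2) :=
        integral_const_mul _ _
    _ ≤ (1 + R) * (1 + |c|) ^ (ε - 1) * (localMass ε + 2 * R * 2) := by
        gcongr
        exact setIntegral_localKernel_add_one_le hR h0 hS c 2 (by norm_num)
    _ = _ := by ring

/-! ### Principal values with the Hilbert kernel -/

/-- A bounded measurable set `S` together with a point `c` and a radius `d ≤ 1` around `c` within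
which `S` has no border. -/
structure Regular (S : Set ℝ) (R c d : ℝ) : Prop where
  measurableSet : MeasurableSet S
  subset_Icc : S ⊆ Set.Icc (-R) R
  pos : 0 < d
  le_one : d ≤ 1
  inside_or_outside : Set.Ioo (c - d) (c + d) ⊆ S ∨ Disjoint (Set.Ioo (c - d) (c + d)) S

/-- The integrand `f t / (t - c)` with the value `f c` subtracted from `f t` within the distance `d`
of the singularity. For `f` Hölder continuous at `c` it is integrable, and its integral is the
principal value. -/
noncomputable def regularised (c d : ℝ) (f : ℝ → ℝ) (t : ℝ) : ℝ :=
  (f t - (Set.Ioo (c - d) (c + d)).indicator (fun _ => f c) t) / (t - c)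

theorem mem_Ioo_iff_abs_sub_lt {c d t : ℝ} : t ∈ Set.Ioo (c - d) (c + d) ↔ |t - c| < d := by
  rw [abs_lt, Set.mem_Ioo]; constructor <;> rintro ⟨h1, h2⟩ <;> constructor <;> linarith

theorem mem_Icc_iff_abs_sub_le {c d t : ℝ} : t ∈ Set.Icc (c - d) (c + d) ↔ |t - c| ≤ d := by
  rw [abs_le, Set.mem_Icc]; constructor <;> rintro ⟨h1, h2⟩ <;> constructor <;> linarith

/-- The factor `d ^ (-ε)` with arbitrarily small `ε` keeps the bound in every `L_p`, `p < ∞`, as a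
function of the distance `d` to the border; the factor `1 / d` that comes from bounding the kernel
away from `c` by `1 / d` would not. -/
theorem abs_regularised_le {c d N γ ε : ℝ} {f : ℝ → ℝ} (hd : 0 < d) (hd1 : d ≤ 1) (h0 : 0 < ε)
    (hεγ : ε ≤ γ) (hN : 0 ≤ N) (hb : ∀ t, |f t| ≤ N) (hf : ∀ t, |f t - f c| ≤ N * |t - c| ^ γ)
    (t : ℝ) : |regularised c d f t| ≤ N * d ^ (-ε) * |t - c| ^ (ε - 1) := by
  rcases eq_or_ne t c with rfl | htc
  · simp only [regularised, sub_self, div_zero, abs_zero]; positivity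
  have hu : 0 < |t - c| := abs_pos.2 (sub_ne_zero.2 htc)
  rw [regularised, abs_div, div_le_iff₀ hu, mul_assoc]
  have : |t - c| ^ (ε - 1) * |t - c| = |t - c| ^ ε := by
    conv_lhs => rw [← Real.rpow_one |t - c|, ← Real.rpow_mul hu.le, ← Real.rpow_add hu]
    simp
  rw [this]
  by_cases h : t ∈ Set.Ioo (c - d) (c + d)
  · rw [Set.indicator_of_mem h]
    rw [mem_Ioo_iff_abs_sub_lt] at h
    have h1 : 1 ≤ d ^ (-ε) := Real.one_le_rpow_of_pos_of_le_one_of_nonpos hd hd1 (by linarith)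
    have h2 : |t - c| ^ γ ≤ |t - c| ^ ε :=
      Real.rpow_le_rpow_of_exponent_ge hu (by linarith) hεγ
    calc |f t - f c| ≤ N * |t - c| ^ γ := hf t
      _ ≤ N * |t - c| ^ ε := by gcongr
      _ ≤ N * d ^ (-ε) * |t - c| ^ ε := by
          gcongr
          nlinarith
  · rw [Set.indicator_of_notMem h, sub_zero]
    rw [mem_Ioo_iff_abs_sub_lt, not_lt] at h
    have h1 : 1 ≤ d ^ (-ε) * |t - c| ^ ε := by
      rw [Real.rpow_neg hd.le, inv_mul_eq_div, one_le_div (by positivity)]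
      gcongr
    calc |f t| ≤ N * 1 := by rw [mul_one]; exact hb t
      _ ≤ N * (d ^ (-ε) * |t - c| ^ ε) := by gcongr
      _ = _ := by ring

theorem measurable_regularised {c d : ℝ} {f : ℝ → ℝ} (hf : Measurable f) :
    Measurable (regularised c d f) := by
  unfold regularised
  exact (hf.sub (measurable_const.indicator measurableSet_Ioo)).div
    (measurable_id.sub_const c)

/-- The subtracted part of the integrand is odd about `c` and does not contribute to the truncated
integrals. -/
theorem setIntegral_eq_zero_of_odd {S : Set ℝ} {c d R δ : ℝ} (hS : Regular S R c d) (a : ℝ) :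
    ∫ t in S \ Set.Icc (c - δ) (c + δ),
      (Set.Ioo (c - d) (c + d)).indicator (fun _ => a) t / (t - c) = 0 := by
  rw [← integral_indicator (hS.measurableSet.diff measurableSet_Icc)]
  set h : ℝ → ℝ := fun t => (S \ Set.Icc (c - δ) (c + δ)).indicator
    (fun t => (Set.Ioo (c - d) (c + d)).indicator (fun _ => a) t / (t - c)) t with hh
  have hzero : ∀ t, t ∉ Set.Ioo (c - d) (c + d) → h t = 0 := fun t ht => by
    rw [hh]
    dsimp only
    exact Set.indicator_apply_eq_zero.2 fun _ => by rw [Set.indicator_of_notMem ht, zero_div]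
  rcases hS.inside_or_outside with hin | hout
  · have hodd : ∀ t, h (2 * c - t) = - h t := by
      intro t
      have e1 : |2 * c - t - c| = |t - c| := by
        rw [← abs_neg]; congr 1; ring
      by_cases h1 : t ∈ Set.Ioo (c - d) (c + d)
      · have h2 : 2 * c - t ∈ Set.Ioo (c - d) (c + d) := by
          rw [mem_Ioo_iff_abs_sub_lt] at h1 ⊢; rwa [e1]
        by_cases h3 : t ∈ Set.Icc (c - δ) (c + δ)
        · have h4 : 2 * c - t ∈ Set.Icc (c - δ) (c + δ) := by
            rw [mem_Icc_iff_abs_sub_le] at h3 ⊢; rwa [e1]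
          rw [hh]
          dsimp only
          rw [Set.indicator_of_notMem (fun h5 => h5.2 h4),
            Set.indicator_of_notMem (fun h5 => h5.2 h3), neg_zero]
        · have h4 : 2 * c - t ∉ Set.Icc (c - δ) (c + δ) := by
            rw [mem_Icc_iff_abs_sub_le] at h3 ⊢; rwa [e1]
          have h5 : 2 * c - t ∈ S \ Set.Icc (c - δ) (c + δ) := ⟨hin h2, h4⟩
          have h6 : t ∈ S \ Set.Icc (c - δ) (c + δ) := ⟨hin h1, h3⟩
          rw [hh]
          dsimp only
          rw [Set.indicator_of_mem h5, Set.indicator_of_mem h6,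
            Set.indicator_of_mem h2, Set.indicator_of_mem h1, ← div_neg]
          congr 1; ring
      · have h2 : 2 * c - t ∉ Set.Ioo (c - d) (c + d) := by
          rw [mem_Ioo_iff_abs_sub_lt] at h1 ⊢; rwa [e1]
        rw [hzero _ h1, hzero _ h2, neg_zero]
    have h1 := integral_sub_left_eq_self h volume (2 * c)
    simp only [hodd, integral_neg] at h1
    linarith
  · have : h = fun _ => 0 := by
      funext t
      by_cases h1 : t ∈ S
      · exact hzero t fun h2 => Set.disjoint_left.1 hout h2 h1
      · exact Set.indicator_of_notMem (fun h2 => h1 h2.1) _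
    rw [this, integral_zero]

theorem tendsto_setIntegral_diff_Icc {S : Set ℝ} {c : ℝ} {g : ℝ → ℝ}
    (hg : IntegrableOn g S) :
    Tendsto (fun δ => ∫ t in S \ Set.Icc (c - δ) (c + δ), g t) (𝓝[>] 0) (𝓝 (∫ t in S, g t)) := by
  have e : ∀ δ : ℝ, ∫ t in S \ Set.Icc (c - δ) (c + δ), g t
      = ∫ t in S, (Set.Icc (c - δ) (c + δ))ᶜ.indicator g t := fun δ => by
    rw [setIntegral_indicator measurableSet_Icc.compl, Set.sdiff_eq]
  simp_rw [e]
  refine tendsto_integral_filter_of_dominated_convergence (fun t => |g t|)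
    (Eventually.of_forall fun δ => hg.1.indicator measurableSet_Icc.compl)
    (Eventually.of_forall fun δ => Eventually.of_forall fun t => ?_) hg.abs ?_
  · by_cases h : t ∈ (Set.Icc (c - δ) (c + δ))ᶜ
    · rw [Set.indicator_of_mem h, Real.norm_eq_abs]
    · rw [Set.indicator_of_notMem h, norm_zero]; positivity
  · filter_upwards [ae_restrict_of_ae (Measure.ae_ne volume c)] with t ht
    have hpos : 0 < |t - c| := abs_pos.2 (sub_ne_zero.2 ht)
    refine tendsto_const_nhds.congr' ?_
    filter_upwards [nhdsWithin_le_nhds (Iio_mem_nhds hpos)] with δ hδ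
    rw [Set.indicator_of_mem]
    rw [Set.mem_compl_iff, mem_Icc_iff_abs_sub_le, not_le]
    exact hδ

/-- A measurable function that is bounded by `N` and satisfies a Hölder condition of exponent `γ`
and constant `N` at the single point `c`. -/
structure HoelderAt (f : ℝ → ℝ) (N γ c : ℝ) : Prop where
  measurable : Measurable f
  abs_le : ∀ t, |f t| ≤ N
  abs_sub_le : ∀ t, |f t - f c| ≤ N * |t - c| ^ γ

theorem HoelderAt.nonneg {f : ℝ → ℝ} {N γ c : ℝ} (hf : HoelderAt f N γ c) : 0 ≤ N :=
  (abs_nonneg _).trans (hf.abs_le 0)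

section

variable {S : Set ℝ} {R c d N γ ε : ℝ} {f : ℝ → ℝ}

theorem HoelderAt.integrableOn_regularised (hf : HoelderAt f N γ c) (hS : Regular S R c d)
    (h0 : 0 < ε) (h1 : ε ≤ 1) (hεγ : ε ≤ γ) : IntegrableOn (regularised c d f) S :=
  ((integrableOn_kernel h0 h1 hS.subset_Icc c).const_mul (N * d ^ (-ε))).mono'
    (measurable_regularised hf.measurable).aestronglyMeasurable
    (Eventually.of_forall fun t => abs_regularised_le hS.pos hS.le_one h0 hεγ hf.nonneg hf.abs_le
      hf.abs_sub_le t)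

theorem HoelderAt.integrableOn_diff (hf : HoelderAt f N γ c) (hS : Regular S R c d) {δ : ℝ}
    (hδ : 0 < δ) : IntegrableOn (fun t => f t / (t - c)) (S \ Set.Icc (c - δ) (c + δ)) := by
  have hfin : volume (S \ Set.Icc (c - δ) (c + δ)) < ∞ :=
    (measure_mono (Set.sdiff_subset.trans hS.subset_Icc)).trans_lt measure_Icc_lt_top
  refine Measure.integrableOn_of_bounded (M := N / δ) hfin.ne
    (hf.measurable.div (measurable_id.sub_const c)).aestronglyMeasurable ?_
  filter_upwards [ae_restrict_mem (hS.measurableSet.diff measurableSet_Icc)] with t ht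
  have h2 := ht.2
  rw [mem_Icc_iff_abs_sub_le, not_le] at h2
  rw [norm_div, Real.norm_eq_abs, Real.norm_eq_abs]
  have := hf.nonneg
  gcongr
  exact hf.abs_le t

theorem HoelderAt.tendsto_truncIntegral (hf : HoelderAt f N γ c) (hS : Regular S R c d)
    (hγ : 0 < γ) :
    Tendsto (truncIntegral S c fun t => f t / (t - c)) (𝓝[>] 0)
      (𝓝 (∫ t in S, regularised c d f t)) := by
  have hg := hf.integrableOn_regularised hS (ε := min γ 1) (by positivity) (by simp) (by simp)
  refine (tendsto_setIntegral_diff_Icc (c := c) hg).congr' ?_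
  filter_upwards [self_mem_nhdsWithin] with δ hδ
  have hi := hf.integrableOn_diff hS hδ
  have hi2 := hg.mono_set (Set.sdiff_subset (t := Set.Icc (c - δ) (c + δ)))
  have hpt : ∀ t, regularised c d f t = f t / (t - c)
      - (Set.Ioo (c - d) (c + d)).indicator (fun _ => f c) t / (t - c) := fun t => by
    rw [regularised, sub_div]
  have hi3 : IntegrableOn (fun t => (Set.Ioo (c - d) (c + d)).indicator (fun _ => f c) t / (t - c))
      (S \ Set.Icc (c - δ) (c + δ)) := by
    refine (hi.sub hi2).congr (Eventually.of_forall fun t => ?_)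
    simp only [Pi.sub_apply, hpt]; ring
  simp_rw [hpt]
  rw [integral_sub hi hi3, setIntegral_eq_zero_of_odd hS, sub_zero, truncIntegral]

theorem HoelderAt.pvExists (hf : HoelderAt f N γ c) (hS : Regular S R c d) (hγ : 0 < γ) :
    PVExists S c fun t => f t / (t - c) :=
  ⟨fun _ hδ => hf.integrableOn_diff hS hδ, _, hf.tendsto_truncIntegral hS hγ⟩

theorem HoelderAt.pvIntegral_eq (hf : HoelderAt f N γ c) (hS : Regular S R c d) (hγ : 0 < γ) :
    pvIntegral S c (fun t => f t / (t - c)) = ∫ t in S, regularised c d f t :=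
  (hf.tendsto_truncIntegral hS hγ).limUnder_eq

theorem HoelderAt.abs_pvIntegral_le (hf : HoelderAt f N γ c) (hS : Regular S R c d)
    (h0 : 0 < ε) (h1 : ε ≤ 1) (hεγ : ε ≤ γ) :
    |pvIntegral S c fun t => f t / (t - c)| ≤ N * (d ^ (-ε) * kernelMass ε S c) := by
  rw [hf.pvIntegral_eq hS (h0.trans_le hεγ), ← mul_assoc, kernelMass, ← integral_const_mul]
  exact norm_integral_le_of_norm_le (f := regularised c d f)
    ((integrableOn_kernel h0 h1 hS.subset_Icc c).const_mul _)
    (Eventually.of_forall fun t => abs_regularised_le hS.pos hS.le_one h0 hεγ hf.nonneg hf.abs_le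
      hf.abs_sub_le t)

end

/-! ### Hölder continuous dependence on parameters -/

/-- Functions on a metric space that are bounded by `N` and Hölder continuous of exponent `β` with
constant `N`. -/
structure Hoelder {P : Type*} [PseudoMetricSpace P] (F : P → ℝ) (N β : ℝ) : Prop where
  abs_le : ∀ p, |F p| ≤ N
  abs_sub_le : ∀ p q, |F p - F q| ≤ N * dist p q ^ β

namespace Hoelder

variable {P : Type*} [PseudoMetricSpace P]

theorem nonneg {F : P → ℝ} {N β : ℝ} (hF : Hoelder F N β) (p : P) : 0 ≤ N :=
  (abs_nonneg _).trans (hF.abs_le p)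

theorem continuous {F : P → ℝ} {N β : ℝ} (hF : Hoelder F N β) (hβ : 0 < β) : Continuous F := by
  refine continuous_iff_continuousAt.2 fun p => ?_
  rw [ContinuousAt, tendsto_iff_dist_tendsto_zero]
  have h : Tendsto (fun q => N * dist q p ^ β) (𝓝 p) (𝓝 0) := by
    have h1 : Continuous fun q => N * dist q p ^ β :=
      continuous_const.mul ((continuous_id.dist continuous_const).rpow_const
        fun _ => Or.inr hβ.le)
    simpa [Real.zero_rpow hβ.ne'] using h1.tendsto p
  exact squeeze_zero (fun _ => dist_nonneg) (fun q => hF.abs_sub_le q p) h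

theorem mul {F G : P → ℝ} {N M β : ℝ} (hF : Hoelder F N β) (hG : Hoelder G M β) :
    Hoelder (fun p => F p * G p) (2 * (N * M)) β where
  abs_le p := by
    have hN := hF.nonneg p
    have hM := hG.nonneg p
    rw [abs_mul]
    have : |F p| * |G p| ≤ N * M :=
      mul_le_mul (hF.abs_le p) (hG.abs_le p) (abs_nonneg _) hN
    nlinarith
  abs_sub_le p q := by
    have hN := hF.nonneg p
    have e : F p * G p - F q * G q = (F p - F q) * G p + F q * (G p - G q) := by ring
    rw [e]
    refine (abs_add_le _ _).trans ?_
    rw [abs_mul, abs_mul]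
    have h1 : |F p - F q| * |G p| ≤ N * dist p q ^ β * M :=
      mul_le_mul (hF.abs_sub_le p q) (hG.abs_le p) (abs_nonneg _) (by positivity)
    have h2 : |F q| * |G p - G q| ≤ N * (M * dist p q ^ β) :=
      mul_le_mul (hF.abs_le q) (hG.abs_sub_le p q) (abs_nonneg _) hN
    linarith

theorem comp_of_dist_le {Q : Type*} [PseudoMetricSpace Q] {F : P → ℝ} {N β : ℝ}
    (hF : Hoelder F N β) (hβ : 0 ≤ β) {u : Q → P} (hu : ∀ p q, dist (u p) (u q) ≤ dist p q) :
    Hoelder (fun q => F (u q)) N β where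
  abs_le q := hF.abs_le _
  abs_sub_le p q := by
    have := hF.nonneg (u p)
    refine (hF.abs_sub_le _ _).trans ?_
    gcongr
    exact hu p q

/-- A bounded Lipschitz function is Hölder continuous of every exponent `β ≤ 1`. -/
theorem of_lipschitz {F : P → ℝ} {K β : ℝ} (hK : 0 ≤ K) (hβ0 : 0 ≤ β) (hβ : β ≤ 1)
    (hb : ∀ p, |F p| ≤ 1) (hF : ∀ p q, |F p - F q| ≤ K * dist p q) : Hoelder F (2 + K) β where
  abs_le p := (hb p).trans (by linarith)
  abs_sub_le p q := by
    rcases le_total (dist p q) 1 with h | h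
    · have h1 : dist p q ≤ dist p q ^ β := by
        conv_lhs => rw [← Real.rpow_one (dist p q)]
        rcases (dist_nonneg (x := p) (y := q)).eq_or_lt with h0 | h0
        · rw [← h0, Real.zero_rpow one_ne_zero]; positivity
        · exact Real.rpow_le_rpow_of_exponent_ge h0 h hβ
      calc _ ≤ K * dist p q := hF p q
        _ ≤ (2 + K) * dist p q ^ β := by gcongr; linarith
    · have h1 : 1 ≤ dist p q ^ β := Real.one_le_rpow h hβ0
      calc |F p - F q| ≤ |F p| + |F q| := abs_sub _ _
        _ ≤ (2 + K) * 1 := by linarith [hb p, hb q]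
        _ ≤ _ := by gcongr

variable {F : P × ℝ → ℝ} {N β c : ℝ}

theorem hoelderAt {f : ℝ → ℝ} (hf : Hoelder f N β) (hβ : 0 < β) (c : ℝ) : HoelderAt f N β c where
  measurable := (hf.continuous hβ).measurable
  abs_le := hf.abs_le
  abs_sub_le t := by simpa [Real.dist_eq] using hf.abs_sub_le t c

theorem section_right (hF : Hoelder F N β) (hβ : 0 ≤ β) (p : P) :
    Hoelder (fun t => F (p, t)) N β :=
  hF.comp_of_dist_le hβ fun s t => by simp [Prod.dist_eq]

/-- Half of the Hölder exponent of `F` is spent on the dependence on the parameter, the other half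
remains for the integration variable. -/
theorem hoelderAt_sub (hF : Hoelder F N β) (hβ : 0 < β) (p q : P) (c : ℝ) :
    HoelderAt (fun t => F (p, t) - F (q, t)) (2 * N * dist p q ^ (β / 2)) (β / 2) c where
  measurable := ((hF.section_right hβ.le p).continuous hβ).measurable.sub
    ((hF.section_right hβ.le q).continuous hβ).measurable
  abs_le t := by
    have hN := hF.nonneg (p, t)
    rcases le_total (dist p q) 1 with h | h
    · have h1 : dist p q ^ β ≤ dist p q ^ (β / 2) := by
        rcases (dist_nonneg (x := p) (y := q)).eq_or_lt with h0 | h0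
        · rw [← h0, Real.zero_rpow hβ.ne']; positivity
        · exact Real.rpow_le_rpow_of_exponent_ge h0 h (by linarith)
      have h2 := hF.abs_sub_le (p, t) (q, t)
      simp only [Prod.dist_eq, dist_self, dist_nonneg, max_eq_left] at h2
      have : N * dist p q ^ β ≤ N * dist p q ^ (β / 2) := by gcongr
      have : 0 ≤ N * dist p q ^ (β / 2) := by positivity
      linarith
    · have h1 : 1 ≤ dist p q ^ (β / 2) := Real.one_le_rpow h (by linarith)
      calc _ ≤ |F (p, t)| + |F (q, t)| := abs_sub _ _
        _ ≤ 2 * N * 1 := by linarith [hF.abs_le (p, t), hF.abs_le (q, t)]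
        _ ≤ _ := by gcongr
  abs_sub_le t := by
    have hN := hF.nonneg (p, t)
    have hsplit : ∀ a b : ℝ, 0 ≤ a → a ≤ b → a ^ β ≤ a ^ (β / 2) * b ^ (β / 2) := by
      intro a b ha hab
      calc a ^ β = a ^ (β / 2) * a ^ (β / 2) := by
            rw [← Real.rpow_add_of_nonneg ha (by linarith) (by linarith)]; congr 1; ring
        _ ≤ _ := by gcongr
    have h1 := hF.abs_sub_le (p, t) (q, t)
    have h2 := hF.abs_sub_le (p, c) (q, c)
    have h3 := hF.abs_sub_le (p, t) (p, c)
    have h4 := hF.abs_sub_le (q, t) (q, c)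
    simp only [Prod.dist_eq, dist_self, dist_nonneg, max_eq_left, max_eq_right, Real.dist_eq,
      abs_nonneg] at h1 h2 h3 h4
    -- The increment is at most `2 N` times the smaller of `|t - c| ^ β` and `dist p q ^ β`, hence
    -- at most `2 N` times their geometric mean.
    rcases le_total |t - c| (dist p q) with h | h
    · have h5 := mul_le_mul_of_nonneg_left (hsplit _ _ (abs_nonneg _) h) hN
      calc |F (p, t) - F (q, t) - (F (p, c) - F (q, c))|
          = |(F (p, t) - F (p, c)) - (F (q, t) - F (q, c))| := by congr 1; ring
        _ ≤ |F (p, t) - F (p, c)| + |F (q, t) - F (q, c)| := abs_sub _ _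
        _ ≤ _ := by linarith
    · have h5 := mul_le_mul_of_nonneg_left (hsplit _ _ dist_nonneg h) hN
      refine (abs_sub _ _).trans ?_
      linarith

/-- The principal value with the Hilbert kernel depends Hölder continuously on a parameter. -/
theorem hoelder_pvIntegral (hF : Hoelder F N β) (hβ : 0 < β) {S : Set ℝ} {R d ε : ℝ}
    (hS : Regular S R c d) (h0 : 0 < ε) (h1 : ε ≤ 1) (hε : ε ≤ β / 2) :
    Hoelder (fun p => pvIntegral S c fun t => F (p, t) / (t - c))
      (2 * N * (d ^ (-ε) * kernelMass ε S c)) (β / 2) where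
  abs_le p := by
    have hN := hF.nonneg (p, 0)
    have hW : 0 ≤ d ^ (-ε) * kernelMass ε S c :=
      mul_nonneg (Real.rpow_nonneg hS.pos.le _) (kernelMass_nonneg _ _ _)
    have := ((hF.section_right hβ.le p).hoelderAt hβ c).abs_pvIntegral_le hS h0 h1
      (by linarith)
    nlinarith [mul_nonneg hN hW]
  abs_sub_le p q := by
    have hp := (hF.section_right hβ.le p).hoelderAt hβ c
    have hq := (hF.section_right hβ.le q).hoelderAt hβ c
    have hpq := hF.hoelderAt_sub hβ p q c
    have hlin : pvIntegral S c (fun t => F (p, t) / (t - c))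
        - pvIntegral S c (fun t => F (q, t) / (t - c))
        = pvIntegral S c (fun t => (F (p, t) - F (q, t)) / (t - c)) := by
      rw [hp.pvIntegral_eq hS hβ, hq.pvIntegral_eq hS hβ, hpq.pvIntegral_eq hS (by linarith),
        ← integral_sub (hp.integrableOn_regularised hS h0 h1 (by linarith))
          (hq.integrableOn_regularised hS h0 h1 (by linarith))]
      congr 1
      funext t
      rw [regularised, regularised, regularised, ← sub_div]
      congr 1
      by_cases ht : t ∈ Set.Ioo (c - d) (c + d)
      · simp only [Set.indicator_of_mem ht]; ring
      · simp only [Set.indicator_of_notMem ht]; ring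
    rw [hlin]
    refine (hpq.abs_pvIntegral_le hS h0 h1 hε).trans (le_of_eq ?_)
    ring

end Hoelder

theorem PVExists.const_mul {S : Set ℝ} {c : ℝ} {f : ℝ → ℝ} (hf : PVExists S c f) (a : ℝ) :
    PVExists S c fun t => a * f t := by
  obtain ⟨h1, L, hL⟩ := hf
  refine ⟨fun δ hδ => (h1 δ hδ).const_mul a, a * L, (hL.const_mul a).congr fun δ => ?_⟩
  simp only [truncIntegral, integral_const_mul]

theorem PVExists.pvIntegral_const_mul {S : Set ℝ} {c : ℝ} {f : ℝ → ℝ} (hf : PVExists S c f)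
    (a : ℝ) : pvIntegral S c (fun t => a * f t) = a * pvIntegral S c f := by
  obtain ⟨h1, L, hL⟩ := hf
  have h2 : Tendsto (truncIntegral S c fun t => a * f t) (𝓝[>] 0) (𝓝 (a * L)) :=
    (hL.const_mul a).congr fun δ => by simp only [truncIntegral, integral_const_mul]
  rw [pvIntegral, pvIntegral, h2.limUnder_eq, hL.limUnder_eq]

/-! ### Iterated principal values -/

section iterated

/-- The inner of three iterated principal values with singularities `c₁` (inner), `c₂` (middle)
and `c₃` (outer). -/
noncomputable def iteratedInner (S₁ : Set ℝ) (c₁ c₂ c₃ : ℝ) (F : ℝ → ℝ → ℝ → ℝ) (u v : ℝ) : ℝ :=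
  pvIntegral S₁ c₁ fun t => F u v t / ((u - c₃) * (v - c₂) * (t - c₁))

/-- The middle of three iterated principal values. -/
noncomputable def iteratedMiddle (S₁ S₂ : Set ℝ) (c₁ c₂ c₃ : ℝ) (F : ℝ → ℝ → ℝ → ℝ) (u : ℝ) : ℝ :=
  pvIntegral S₂ c₂ (iteratedInner S₁ c₁ c₂ c₃ F u)

/-- Three iterated principal values. -/
noncomputable def iteratedOuter (S₁ S₂ S₃ : Set ℝ) (c₁ c₂ c₃ : ℝ) (F : ℝ → ℝ → ℝ → ℝ) : ℝ :=
  pvIntegral S₃ c₃ (iteratedMiddle S₁ S₂ c₁ c₂ c₃ F)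

variable {S₁ S₂ S₃ : Set ℝ} {c₁ c₂ c₃ d₁ d₂ d₃ R N β : ℝ} {F : ℝ → ℝ → ℝ → ℝ}

theorem Hoelder.iteratedInner_integrand_pvExists
    (hF : Hoelder (fun p : (ℝ × ℝ) × ℝ => F p.1.1 p.1.2 p.2) N β) (hβ : 0 < β)
    (h₁ : Regular S₁ R c₁ d₁) (u v : ℝ) :
    PVExists S₁ c₁ fun t => F u v t / ((u - c₃) * (v - c₂) * (t - c₁)) := by
  have := ((((hF.section_right hβ.le (u, v)).hoelderAt hβ c₁).pvExists h₁ hβ).const_mul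
    (1 / ((u - c₃) * (v - c₂))))
  refine (congrArg _ (funext fun t => ?_)).mp this
  rw [div_mul_div_comm, one_mul]

theorem Hoelder.iteratedInner_eq
    (hF : Hoelder (fun p : (ℝ × ℝ) × ℝ => F p.1.1 p.1.2 p.2) N β) (hβ : 0 < β)
    (h₁ : Regular S₁ R c₁ d₁) (u v : ℝ) :
    iteratedInner S₁ c₁ c₂ c₃ F u v = 1 / (u - c₃) *
      (pvIntegral S₁ c₁ (fun t => F u v t / (t - c₁)) / (v - c₂)) := by
  have := ((((hF.section_right hβ.le (u, v)).hoelderAt hβ c₁).pvExists h₁ hβ).pvIntegral_const_mul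
    (1 / ((u - c₃) * (v - c₂))))
  rw [div_mul_div_comm, one_mul, ← one_mul (pvIntegral S₁ c₁ _), mul_div_right_comm,
    ← this, iteratedInner]
  congr 1
  funext t
  rw [div_mul_div_comm, one_mul]

theorem Hoelder.iteratedInner_pvExists
    (hF : Hoelder (fun p : (ℝ × ℝ) × ℝ => F p.1.1 p.1.2 p.2) N β) (hβ : 0 < β) (hβ1 : β ≤ 1)
    (h₁ : Regular S₁ R c₁ d₁) (h₂ : Regular S₂ R c₂ d₂) (u : ℝ) :
    PVExists S₂ c₂ (iteratedInner S₁ c₁ c₂ c₃ F u) := by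
  have hG := hF.hoelder_pvIntegral hβ h₁ (ε := β / 2) (by linarith) (by linarith) le_rfl
  have := ((((hG.section_right (by linarith) u).hoelderAt (by linarith) c₂).pvExists h₂
    (by linarith)).const_mul (1 / (u - c₃)))
  refine (congrArg _ (funext fun v => ?_)).mp this
  exact (hF.iteratedInner_eq hβ h₁ u v).symm

theorem Hoelder.iteratedMiddle_eq
    (hF : Hoelder (fun p : (ℝ × ℝ) × ℝ => F p.1.1 p.1.2 p.2) N β) (hβ : 0 < β) (hβ1 : β ≤ 1)
    (h₁ : Regular S₁ R c₁ d₁) (h₂ : Regular S₂ R c₂ d₂) (u : ℝ) :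
    iteratedMiddle S₁ S₂ c₁ c₂ c₃ F u =
      pvIntegral S₂ c₂ (fun v => pvIntegral S₁ c₁ (fun t => F u v t / (t - c₁)) / (v - c₂))
        / (u - c₃) := by
  have hG := hF.hoelder_pvIntegral hβ h₁ (ε := β / 2) (by linarith) (by linarith) le_rfl
  have := ((((hG.section_right (by linarith) u).hoelderAt (by linarith) c₂).pvExists h₂
    (by linarith)).pvIntegral_const_mul (1 / (u - c₃)))
  rw [iteratedMiddle, div_eq_inv_mul, ← one_div, ← this]
  congr 1
  funext v
  exact hF.iteratedInner_eq hβ h₁ u v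

/-- The numerator that remains for the outer principal value is Hölder continuous with a quarter of
the original exponent: each of the two inner principal values costs half of it. -/
theorem Hoelder.middle
    (hF : Hoelder (fun p : (ℝ × ℝ) × ℝ => F p.1.1 p.1.2 p.2) N β) (hβ : 0 < β)
    (h₁ : Regular S₁ R c₁ d₁) (h₂ : Regular S₂ R c₂ d₂) {ε : ℝ} (h0 : 0 < ε) (hε1 : ε ≤ 1)
    (hε : ε ≤ β / 4) :
    Hoelder (fun u => pvIntegral S₂ c₂ (fun v =>
        pvIntegral S₁ c₁ (fun t => F u v t / (t - c₁)) / (v - c₂)))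
      (4 * N * (d₁ ^ (-ε) * kernelMass ε S₁ c₁) * (d₂ ^ (-ε) * kernelMass ε S₂ c₂)) (β / 4) := by
  have hG := hF.hoelder_pvIntegral hβ h₁ h0 hε1 (by linarith)
  have hH := hG.hoelder_pvIntegral (by linarith) h₂ h0 hε1 (by linarith)
  convert hH using 1 <;> ring

theorem Hoelder.iteratedMiddle_pvExists
    (hF : Hoelder (fun p : (ℝ × ℝ) × ℝ => F p.1.1 p.1.2 p.2) N β) (hβ : 0 < β) (hβ1 : β ≤ 1)
    (h₁ : Regular S₁ R c₁ d₁) (h₂ : Regular S₂ R c₂ d₂) (h₃ : Regular S₃ R c₃ d₃) :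
    PVExists S₃ c₃ (iteratedMiddle S₁ S₂ c₁ c₂ c₃ F) := by
  have hH := hF.middle hβ h₁ h₂ (ε := β / 4) (by linarith) (by linarith) le_rfl
  have := (hH.hoelderAt (by linarith) c₃).pvExists h₃ (by linarith)
  refine (congrArg _ (funext fun u => ?_)).mp this
  exact (hF.iteratedMiddle_eq hβ hβ1 h₁ h₂ u).symm

theorem Hoelder.abs_iteratedOuter_le
    (hF : Hoelder (fun p : (ℝ × ℝ) × ℝ => F p.1.1 p.1.2 p.2) N β) (hβ : 0 < β) (hβ1 : β ≤ 1)
    (h₁ : Regular S₁ R c₁ d₁) (h₂ : Regular S₂ R c₂ d₂) (h₃ : Regular S₃ R c₃ d₃)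
    {ε : ℝ} (h0 : 0 < ε) (hε : ε ≤ β / 4) :
    |iteratedOuter S₁ S₂ S₃ c₁ c₂ c₃ F| ≤ 4 * N * (d₁ ^ (-ε) * kernelMass ε S₁ c₁) *
      (d₂ ^ (-ε) * kernelMass ε S₂ c₂) * (d₃ ^ (-ε) * kernelMass ε S₃ c₃) := by
  have hH := hF.middle hβ h₁ h₂ h0 (by linarith) hε
  have := (hH.hoelderAt (by linarith) c₃).abs_pvIntegral_le h₃ h0 (by linarith) hε
  rw [iteratedOuter]
  convert this using 4 with u
  exact hF.iteratedMiddle_eq hβ hβ1 h₁ h₂ u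

end iterated

/-! ### Principal values and null sets -/

section congruence

variable {S : Set ℝ} {c : ℝ} {f g : ℝ → ℝ}

theorem truncIntegral_congr_ae (h : ∀ᵐ t, f t = g t) :
    truncIntegral S c f = truncIntegral S c g :=
  funext fun _ => integral_congr_ae (ae_restrict_of_ae h)

theorem pvIntegral_congr_ae (h : ∀ᵐ t, f t = g t) : pvIntegral S c f = pvIntegral S c g := by
  rw [pvIntegral, pvIntegral, truncIntegral_congr_ae h]

theorem PVExists.congr_ae (hg : PVExists S c g) (h : ∀ᵐ t, f t = g t) : PVExists S c f := by
  refine ⟨fun δ hδ => (hg.1 δ hδ).congr ?_, ?_⟩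
  · filter_upwards [ae_restrict_of_ae h] with t ht using ht.symm
  · rw [truncIntegral_congr_ae h]; exact hg.2

variable {S₁ S₂ S₃ : Set ℝ} {c₁ c₂ c₃ : ℝ} {F G : ℝ → ℝ → ℝ → ℝ}

theorem iteratedInner_congr_ae {u v : ℝ} (h : ∀ᵐ t, F u v t = G u v t) :
    iteratedInner S₁ c₁ c₂ c₃ F u v = iteratedInner S₁ c₁ c₂ c₃ G u v :=
  pvIntegral_congr_ae (h.mono fun t ht => by rw [ht])

theorem iteratedMiddle_congr_ae {u : ℝ} (h : ∀ᵐ v, ∀ᵐ t, F u v t = G u v t) :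
    iteratedMiddle S₁ S₂ c₁ c₂ c₃ F u = iteratedMiddle S₁ S₂ c₁ c₂ c₃ G u :=
  pvIntegral_congr_ae (h.mono fun _ hv => iteratedInner_congr_ae hv)

theorem iteratedOuter_congr_ae (h : ∀ᵐ u, ∀ᵐ v, ∀ᵐ t, F u v t = G u v t) :
    iteratedOuter S₁ S₂ S₃ c₁ c₂ c₃ F = iteratedOuter S₁ S₂ S₃ c₁ c₂ c₃ G :=
  pvIntegral_congr_ae (h.mono fun _ hu => iteratedMiddle_congr_ae hu)

end congruence

/-! ### Measurability of principal values -/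

section measurability

/-- The limit of the truncated integrals along `δ = 1 / (n + 1)`. It agrees with the principal value
where that exists, and is measurable in parameters everywhere. -/
noncomputable def pvSeq (S : Set ℝ) (c : ℝ) (f : ℝ → ℝ) : ℝ :=
  limUnder atTop fun n : ℕ => truncIntegral S c f (1 / (n + 1))

theorem PVExists.pvIntegral_eq_pvSeq {S : Set ℝ} {c : ℝ} {f : ℝ → ℝ} (h : PVExists S c f) :
    pvIntegral S c f = pvSeq S c f := by
  obtain ⟨-, L, hL⟩ := h
  have hn : Tendsto (fun n : ℕ => (1 : ℝ) / (n + 1)) atTop (𝓝[>] 0) :=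
    tendsto_nhdsWithin_iff.2 ⟨tendsto_one_div_add_atTop_nhds_zero_nat,
      Eventually.of_forall fun n => by simp only [Set.mem_Ioi]; positivity⟩
  rw [pvIntegral, pvSeq, hL.limUnder_eq]
  exact (hL.comp hn).limUnder_eq.symm

theorem measurable_pvSeq {W : Type*} [MeasurableSpace W] {S : W → Set ℝ} {c : W → ℝ}
    {f : W → ℝ → ℝ} (hS : MeasurableSet {p : W × ℝ | p.2 ∈ S p.1}) (hc : Measurable c)
    (hf : Measurable fun p : W × ℝ => f p.1 p.2) :
    Measurable fun w => pvSeq (S w) (c w) (f w) := by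
  refine (StronglyMeasurable.limUnder fun n => ?_).measurable
  have hset : MeasurableSet {p : W × ℝ |
      p.2 ∈ S p.1 \ Set.Icc (c p.1 - 1 / (n + 1)) (c p.1 + 1 / (n + 1))} :=
    hS.diff ((measurableSet_le ((hc.comp measurable_fst).sub_const _) measurable_snd).inter
      (measurableSet_le measurable_snd ((hc.comp measurable_fst).add_const _)))
  have h1 := (hf.indicator hset).stronglyMeasurable.integral_prod_right' (ν := volume)
  refine (congrArg StronglyMeasurable (funext fun w => ?_)).mp h1
  have hw : MeasurableSet (S w \ Set.Icc (c w - 1 / (n + 1)) (c w + 1 / (n + 1))) :=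
    hset.preimage (measurable_prodMk_left (x := w))
  rw [truncIntegral, ← integral_indicator hw]
  rfl

/-- Where all of them exist, iterated principal values agree with the measurable iterated limits. -/
theorem aestronglyMeasurable_iteratedOuter {Z : Type*} [MeasurableSpace Z] {μ : Measure Z}
    {S₁ S₂ S₃ : Z → Set ℝ} {c₁ c₂ c₃ : Z → ℝ} {F : Z → ℝ → ℝ → ℝ → ℝ}
    (hS₁ : MeasurableSet {p : Z × ℝ | p.2 ∈ S₁ p.1})
    (hS₂ : MeasurableSet {p : Z × ℝ | p.2 ∈ S₂ p.1})
    (hS₃ : MeasurableSet {p : Z × ℝ | p.2 ∈ S₃ p.1})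
    (hc₁ : Measurable c₁) (hc₂ : Measurable c₂) (hc₃ : Measurable c₃)
    (hF : Measurable fun p : ((Z × ℝ) × ℝ) × ℝ => F p.1.1.1 p.1.1.2 p.1.2 p.2)
    (hinner : ∀ᵐ z ∂μ, ∀ u v, PVExists (S₁ z) (c₁ z)
      fun t => F z u v t / ((u - c₃ z) * (v - c₂ z) * (t - c₁ z)))
    (hmiddle : ∀ᵐ z ∂μ, ∀ u, PVExists (S₂ z) (c₂ z)
      (iteratedInner (S₁ z) (c₁ z) (c₂ z) (c₃ z) (F z) u))
    (houter : ∀ᵐ z ∂μ, PVExists (S₃ z) (c₃ z)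
      (iteratedMiddle (S₁ z) (S₂ z) (c₁ z) (c₂ z) (c₃ z) (F z))) :
    AEStronglyMeasurable (fun z =>
      iteratedOuter (S₁ z) (S₂ z) (S₃ z) (c₁ z) (c₂ z) (c₃ z) (F z)) μ := by
  have m1 : Measurable fun w : (Z × ℝ) × ℝ => pvSeq (S₁ w.1.1) (c₁ w.1.1)
      fun t => F w.1.1 w.1.2 w.2 t / ((w.1.2 - c₃ w.1.1) * (w.2 - c₂ w.1.1) * (t - c₁ w.1.1)) := by
    refine measurable_pvSeq (S := fun w : (Z × ℝ) × ℝ => S₁ w.1.1) (c := fun w => c₁ w.1.1) ?_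
      (by fun_prop) ?_
    · exact hS₁.preimage (f := fun p : ((Z × ℝ) × ℝ) × ℝ => (p.1.1.1, p.2)) (by fun_prop)
    · exact hF.div (by fun_prop)
  have m2 : Measurable fun w : Z × ℝ => pvSeq (S₂ w.1) (c₂ w.1) fun v => pvSeq (S₁ w.1) (c₁ w.1)
      fun t => F w.1 w.2 v t / ((w.2 - c₃ w.1) * (v - c₂ w.1) * (t - c₁ w.1)) :=
    measurable_pvSeq (S := fun w : Z × ℝ => S₂ w.1) (c := fun w => c₂ w.1)
      (hS₂.preimage (f := fun p : (Z × ℝ) × ℝ => (p.1.1, p.2)) (by fun_prop)) (by fun_prop) m1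
  have m3 := measurable_pvSeq (f := fun z u => pvSeq (S₂ z) (c₂ z) fun v => pvSeq (S₁ z) (c₁ z)
    fun t => F z u v t / ((u - c₃ z) * (v - c₂ z) * (t - c₁ z))) hS₃ hc₃ m2
  refine m3.aestronglyMeasurable.congr ?_
  filter_upwards [hinner, hmiddle, houter] with z h1 h2 h3
  rw [iteratedOuter, h3.pvIntegral_eq_pvSeq]
  congr 1
  funext u
  rw [iteratedMiddle, (h2 u).pvIntegral_eq_pvSeq]
  congr 1
  funext v
  rw [iteratedInner, (h1 u v).pvIntegral_eq_pvSeq]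

end measurability

/-! ### Finite unions of intervals -/

/-- A point off a finite set of borders has a distance to them whose inverse square root is
controlled by those of the single distances. -/
theorem exists_borderDist {ι : Type*} (s : Finset ι) (e : ι → ℝ) (c : ℝ) (h : ∀ i ∈ s, e i ≠ c) :
    ∃ d : ℝ, 0 < d ∧ d ≤ 1 ∧ (∀ i ∈ s, d ≤ |c - e i|) ∧
      d ^ (-(1 / 2) : ℝ) ≤ 1 + ∑ i ∈ s, |c - e i| ^ (-(1 / 2) : ℝ) := by
  classical
  induction s using Finset.induction_on with
  | empty => exact ⟨1, by norm_num, le_rfl, by simp, by simp⟩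
  | insert a s ha ih =>
    obtain ⟨d, h0, h1, h2, h3⟩ := ih fun i hi => h i (Finset.mem_insert_of_mem hi)
    have hpos : 0 < |c - e a| :=
      abs_pos.2 (sub_ne_zero.2 (h a (Finset.mem_insert_self _ _)).symm)
    have hsum : 0 ≤ ∑ i ∈ s, |c - e i| ^ (-(1 / 2) : ℝ) :=
      Finset.sum_nonneg fun i _ => by positivity
    refine ⟨min d |c - e a|, lt_min h0 hpos, (min_le_left _ _).trans h1, ?_, ?_⟩
    · intro i hi
      rcases Finset.mem_insert.1 hi with rfl | hi
      · exact min_le_right _ _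
      · exact (min_le_left _ _).trans (h2 i hi)
    · rw [Finset.sum_insert ha]
      have hx : 0 ≤ |c - e a| ^ (-(1 / 2) : ℝ) := by positivity
      rcases min_choice d |c - e a| with h4 | h4 <;> rw [h4] <;> linarith

theorem regular_iUnion_Icc {ι : Type*} [Finite ι] {a b : ι → ℝ} {R c d : ℝ}
    (ha : ∀ i, -R ≤ a i) (hb : ∀ i, b i ≤ R) (h0 : 0 < d) (h1 : d ≤ 1)
    (hda : ∀ i, d ≤ |c - a i|) (hdb : ∀ i, d ≤ |c - b i|) :
    Regular (⋃ i, Set.Icc (a i) (b i)) R c d where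
  measurableSet := MeasurableSet.iUnion fun _ => measurableSet_Icc
  subset_Icc := Set.iUnion_subset fun i => Set.Icc_subset_Icc (ha i) (hb i)
  pos := h0
  le_one := h1
  inside_or_outside := by
    by_cases h : ∃ i, ∃ t ∈ Set.Ioo (c - d) (c + d), t ∈ Set.Icc (a i) (b i)
    · obtain ⟨i, t, ht, hti⟩ := h
      refine Or.inl fun s hs => Set.mem_iUnion.2 ⟨i, ?_⟩
      obtain ⟨ht1, ht2⟩ := ht
      obtain ⟨ht3, ht4⟩ := hti
      obtain ⟨hs1, hs2⟩ := hs
      constructor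
      · rcases le_abs.1 (hda i) with h | h <;> linarith
      · rcases le_abs.1 (hdb i) with h | h <;> linarith
    · refine Or.inr (Set.disjoint_left.2 fun t ht hti => ?_)
      obtain ⟨i, hi⟩ := Set.mem_iUnion.1 hti
      exact h ⟨i, t, ht, hi⟩

/-! ### The plane as a product -/

/-- The coordinates of a point of the plane. -/
def coords (z : Plane) : ℝ × ℝ := (z 0, z 1)

theorem measurePreserving_coords : MeasurePreserving coords volume volume :=
  (volume_preserving_finTwoArrow ℝ).comp (PiLp.volume_preserving_ofLp (Fin 2))

theorem measurePreserving_point :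
    MeasurePreserving (fun p : ℝ × ℝ => (!₂[p.1, p.2] : Plane)) volume volume := by
  have := (PiLp.volume_preserving_toLp (Fin 2)).comp (volume_preserving_finTwoArrow ℝ).symm
  refine (congrArg (MeasurePreserving · volume volume) (funext fun p => ?_)).mp this
  ext i
  fin_cases i <;> rfl

theorem ae_plane_of_ae_prod {P : ℝ → ℝ → Prop} (h : ∀ᵐ p : ℝ × ℝ, P p.1 p.2) :
    ∀ᵐ z : Plane, P (z 0) (z 1) :=
  measurePreserving_coords.quasiMeasurePreserving.ae h

/-- The graph of a measurable function of the abscissa is a null set. -/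
theorem ae_ne_graph_left {e : ℝ → ℝ} (he : Measurable e) : ∀ᵐ z : Plane, e (z 0) ≠ z 1 := by
  refine ae_plane_of_ae_prod (P := fun x y => e x ≠ y) ?_
  refine (Measure.ae_prod_iff_ae_ae ?_).2 (Eventually.of_forall fun x => ?_)
  · exact (measurableSet_eq_fun (he.comp measurable_fst) measurable_snd).compl
  · exact (Measure.ae_ne volume (e x)).mono fun y hy => hy.symm

theorem ae_swap {P : ℝ → ℝ → Prop} (h : ∀ᵐ p : ℝ × ℝ, P p.1 p.2) :
    ∀ᵐ p : ℝ × ℝ, P p.2 p.1 :=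
  (Measure.measurePreserving_swap (μ := (volume : Measure ℝ))
    (ν := (volume : Measure ℝ))).quasiMeasurePreserving.ae h

theorem ae_ne_graph_right {e : ℝ → ℝ} (he : Measurable e) : ∀ᵐ z : Plane, e (z 1) ≠ z 0 := by
  refine ae_plane_of_ae_prod (P := fun x y => e y ≠ x) ?_
  refine ae_swap (P := fun x y => e x ≠ y) ?_
  refine (Measure.ae_prod_iff_ae_ae ?_).2 (Eventually.of_forall fun x => ?_)
  · exact (measurableSet_eq_fun (he.comp measurable_fst) measurable_snd).compl
  · exact (Measure.ae_ne volume (e x)).mono fun y hy => hy.symm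

theorem ae_ae_of_ae_plane {φ ψ : Plane → ℝ} (h : φ =ᵐ[volume] ψ) :
    ∀ᵐ x : ℝ, ∀ᵐ y : ℝ, φ !₂[x, y] = ψ !₂[x, y] :=
  Measure.ae_ae_of_ae_prod (measurePreserving_point.quasiMeasurePreserving.ae h)

theorem ae_ae_of_ae_plane' {φ ψ : Plane → ℝ} (h : φ =ᵐ[volume] ψ) :
    ∀ᵐ y : ℝ, ∀ᵐ x : ℝ, φ !₂[x, y] = ψ !₂[x, y] :=
  Measure.ae_ae_of_ae_prod (ae_swap (P := fun x y => φ !₂[x, y] = ψ !₂[x, y])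
    (measurePreserving_point.quasiMeasurePreserving.ae h))

theorem ae_abscissa {P : ℝ → Prop} (h : ∀ᵐ x, P x) : ∀ᵐ z : Plane, P (z 0) :=
  measurePreserving_coords.quasiMeasurePreserving.ae
    (Measure.quasiMeasurePreserving_fst.ae (p := P) h)

theorem ae_ordinate {P : ℝ → Prop} (h : ∀ᵐ y, P y) : ∀ᵐ z : Plane, P (z 1) :=
  measurePreserving_coords.quasiMeasurePreserving.ae
    (Measure.quasiMeasurePreserving_snd.ae (p := P) h)

/-! ### The modulation kernels -/

/-- Bounds on the modulation kernels `k` and `l`: bounded by one and Lipschitz with constant `K`. -/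
structure LipschitzKernels (k : ℝ → ℝ) (l : ℝ → ℝ → ℝ) (K : ℝ) : Prop where
  nonneg : 0 ≤ K
  abs_k_le : ∀ u, |k u| ≤ 1
  abs_k_sub_le : ∀ u u', |k u - k u'| ≤ K * |u - u'|
  abs_l_le : ∀ u v, |l u v| ≤ 1
  abs_l_sub_le : ∀ u v u' v', |l u v - l u' v'| ≤ K * (|u - u'| + |v - v'|)

theorem abs_average_le {L a b B : ℝ} (hL : 0 < L) (hab : b - a = L) {f : ℝ → ℝ}
    (hf : ∀ t, |f t| ≤ B) : |1 / L * ∫ t in a..b, f t| ≤ B := by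
  have h := intervalIntegral.norm_integral_le_of_norm_le_const (a := a) (b := b) (f := f) (C := B)
    fun t _ => hf t
  rw [hab, abs_of_pos hL] at h
  rw [abs_mul, abs_of_pos (by positivity), one_div, inv_mul_le_iff₀ hL, mul_comm]
  exact h

theorem abs_average_sub_le {L a b B : ℝ} (hL : 0 < L) (hab : b - a = L) {f g : ℝ → ℝ}
    (hfc : Continuous f) (hgc : Continuous g) (h : ∀ t, |f t - g t| ≤ B) :
    |1 / L * (∫ t in a..b, f t) - 1 / L * ∫ t in a..b, g t| ≤ B := by
  rw [← mul_sub, ← intervalIntegral.integral_sub (hfc.intervalIntegrable _ _)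
    (hgc.intervalIntegrable _ _)]
  exact abs_average_le hL hab h

theorem abs_besselJ0_le (u : ℝ) : |besselJ0 u| ≤ 1 :=
  abs_average_le Real.pi_pos (sub_zero _) fun _ => Real.abs_cos_le_one _

theorem abs_besselJ0_sub_le (u v : ℝ) : |besselJ0 u - besselJ0 v| ≤ |u - v| := by
  refine abs_average_sub_le Real.pi_pos (sub_zero _) (by fun_prop) (by fun_prop) fun t => ?_
  refine (Real.abs_cos_sub_cos_le _ _).trans ?_
  rw [← sub_mul, abs_mul]
  exact mul_le_of_le_one_right (abs_nonneg _) (Real.abs_sin_le_one _)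

theorem Modulation.lipschitzKernels (m : Modulation) {a T : ℝ} (hT : 0 < T) :
    LipschitzKernels (m.k a) (m.l a T) |a| := by
  have hTT : T / 2 - -(T / 2) = T := by ring
  cases m with
  | none =>
    refine ⟨abs_nonneg a, fun u => ?_, fun u u' => ?_, fun u v => ?_, fun u v u' v' => ?_⟩ <;>
      simp only [Modulation.k, Modulation.l, abs_one, le_refl, sub_self, abs_zero] <;> positivity
  | circular =>
    refine ⟨abs_nonneg a, fun u => abs_besselJ0_le _, fun u u' => ?_, fun u v => ?_,
      fun u v u' v' => ?_⟩
    · refine (abs_besselJ0_sub_le _ _).trans (le_of_eq ?_)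
      rw [← mul_sub, abs_mul]
    · refine abs_average_le hT hTT fun t => ?_
      rw [abs_mul]
      exact mul_le_one₀ (Real.abs_cos_le_one _) (abs_nonneg _) (Real.abs_cos_le_one _)
    · refine abs_average_sub_le hT hTT (by fun_prop) (by fun_prop) fun t => ?_
      have key : ∀ w w' s : ℝ, |s| ≤ 1 →
          |Real.cos (a * w * s) - Real.cos (a * w' * s)| ≤ |a| * |w - w'| := by
        intro w w' s hs
        refine (Real.abs_cos_sub_cos_le _ _).trans ?_
        rw [← sub_mul, ← mul_sub, abs_mul, abs_mul]
        exact mul_le_of_le_one_right (by positivity) hs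
      set s := 2 * Real.pi * t / T
      have h1 := key u u' _ (Real.abs_sin_le_one s)
      have h2 := key v v' _ (Real.abs_cos_le_one s)
      have e : Real.cos (a * u * Real.sin s) * Real.cos (a * v * Real.cos s)
          - Real.cos (a * u' * Real.sin s) * Real.cos (a * v' * Real.cos s)
          = (Real.cos (a * u * Real.sin s) - Real.cos (a * u' * Real.sin s))
              * Real.cos (a * v * Real.cos s)
            + Real.cos (a * u' * Real.sin s)
              * (Real.cos (a * v * Real.cos s) - Real.cos (a * v' * Real.cos s)) := by ring
      rw [e, mul_add]
      refine (abs_add_le _ _).trans (add_le_add ?_ ?_)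
      · rw [abs_mul]
        exact (mul_le_of_le_one_right (abs_nonneg _) (Real.abs_cos_le_one _)).trans h1
      · rw [abs_mul]
        exact (mul_le_of_le_one_left (abs_nonneg _) (Real.abs_cos_le_one _)).trans h2

/-! ### Hölder continuity of the numerators -/

theorem norm_point_sub_le (a b a' b' : ℝ) :
    ‖(!₂[a, b] : Plane) - !₂[a', b']‖ ≤ |a - a'| + |b - b'| := by
  rw [EuclideanSpace.norm_eq]
  refine Real.sqrt_le_iff.2 ⟨by positivity, ?_⟩
  simp only [Fin.sum_univ_two, PiLp.sub_apply, Real.norm_eq_abs]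
  simp only [Matrix.cons_val_zero, Matrix.cons_val_one]
  nlinarith [abs_nonneg (a - a'), abs_nonneg (b - b')]

/-- The Hölder condition of exponent `1/2` on the phase. -/
def PhaseHoelder (ψ : Plane → ℝ) (C : ℝ) : Prop :=
  0 ≤ C ∧ ∀ z w, |ψ z - ψ w| ≤ C * ‖z - w‖ ^ (1 / 2 : ℝ)

section numerators

variable {ψ : Plane → ℝ} {k : ℝ → ℝ} {l : ℝ → ℝ → ℝ} {C K : ℝ}

theorem PhaseHoelder.continuous (hψ : PhaseHoelder ψ C) : Continuous ψ := by
  refine continuous_iff_continuousAt.2 fun p => ?_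
  rw [ContinuousAt, tendsto_iff_dist_tendsto_zero]
  have h : Tendsto (fun q => C * ‖q - p‖ ^ (1 / 2 : ℝ)) (𝓝 p) (𝓝 0) := by
    have h1 : Continuous fun q => C * ‖q - p‖ ^ (1 / 2 : ℝ) :=
      continuous_const.mul ((continuous_id.sub continuous_const).norm.rpow_const
        fun _ => Or.inr (by norm_num))
    simpa [Real.zero_rpow] using h1.tendsto p
  exact squeeze_zero (fun _ => dist_nonneg) (fun q => hψ.2 q p) h

theorem PhaseHoelder.hoelder_sin {Q : Type*} [PseudoMetricSpace Q] (hψ : PhaseHoelder ψ C)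
    {A B : Q → Plane} (hA : ∀ p q, ‖A p - A q‖ ≤ 2 * dist p q)
    (hB : ∀ p q, ‖B p - B q‖ ≤ 2 * dist p q) :
    Hoelder (fun q => Real.sin (ψ (A q) - ψ (B q))) (1 + 4 * C) (1 / 2) where
  abs_le q := (Real.abs_sin_le_one _).trans (by linarith [hψ.1])
  abs_sub_le p q := by
    have hC := hψ.1
    have h2 : (2 * dist p q) ^ (1 / 2 : ℝ) ≤ 2 * dist p q ^ (1 / 2 : ℝ) := by
      rw [Real.mul_rpow (by norm_num) dist_nonneg]
      gcongr
      calc (2 : ℝ) ^ (1 / 2 : ℝ) ≤ 2 ^ (1 : ℝ) :=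
            Real.rpow_le_rpow_of_exponent_le (by norm_num) (by norm_num)
        _ = 2 := Real.rpow_one 2
    have key : ∀ G : Q → Plane, (∀ p q, ‖G p - G q‖ ≤ 2 * dist p q) →
        |ψ (G p) - ψ (G q)| ≤ C * (2 * dist p q ^ (1 / 2 : ℝ)) := fun G hG => by
      refine (hψ.2 _ _).trans ?_
      gcongr
      refine (Real.rpow_le_rpow (norm_nonneg _) (hG p q) (by norm_num)).trans h2
    have h3 := key A hA
    have h4 := key B hB
    have h5 : 0 ≤ dist p q ^ (1 / 2 : ℝ) := by positivity
    calc _ ≤ |ψ (A p) - ψ (B p) - (ψ (A q) - ψ (B q))| := Real.abs_sin_sub_sin_le _ _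
      _ = |(ψ (A p) - ψ (A q)) - (ψ (B p) - ψ (B q))| := by congr 1; ring
      _ ≤ |ψ (A p) - ψ (A q)| + |ψ (B p) - ψ (B q)| := abs_sub _ _
      _ ≤ _ := by linarith

theorem LipschitzKernels.hoelder_l {Q : Type*} [PseudoMetricSpace Q]
    (hl : LipschitzKernels k l K) {a b : Q → ℝ} (ha : ∀ p q, |a p - a q| ≤ 2 * dist p q)
    (hb : ∀ p q, |b p - b q| ≤ 2 * dist p q) :
    Hoelder (fun q => l (a q) (b q)) (2 + 4 * K) (1 / 2) := by
  have hK := hl.nonneg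
  refine Hoelder.of_lipschitz (by positivity) (by norm_num) (by norm_num)
    (fun q => hl.abs_l_le _ _) fun p q => (hl.abs_l_sub_le _ _ _ _).trans ?_
  have := mul_le_mul_of_nonneg_left (add_le_add (ha p q) (hb p q)) hK
  linarith

/-- The Hölder bound shared by all numerators. -/
def numeratorBound (C K : ℝ) : ℝ := 2 * ((1 + 4 * C) * (2 + 4 * K))

/-- Numerator of the triple integral of `P_x`, as a function of `x'`, `y'` and `y''`. -/
noncomputable def numeratorX (l : ℝ → ℝ → ℝ) (Φ : Plane → ℝ) (x u v t : ℝ) : ℝ :=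
  Real.sin (Φ !₂[u, v] - Φ !₂[x, t]) * l (u - x) (t - v)

/-- Numerator of the triple integral of `P_y`, as a function of `x'`, `y'` and `x''`. -/
noncomputable def numeratorY (l : ℝ → ℝ → ℝ) (Φ : Plane → ℝ) (y u v t : ℝ) : ℝ :=
  Real.sin (Φ !₂[u, v] - Φ !₂[t, y]) * l (t - u) (v - y)

theorem abs_coord_sub_le (p q : (ℝ × ℝ) × ℝ) :
    |p.1.1 - q.1.1| ≤ dist p q ∧ |p.1.2 - q.1.2| ≤ dist p q ∧ |p.2 - q.2| ≤ dist p q := by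
  refine ⟨?_, ?_, ?_⟩ <;> simp [Prod.dist_eq, Real.dist_eq]

theorem hoelder_numeratorX (hψ : PhaseHoelder ψ C) (hl : LipschitzKernels k l K) (x : ℝ) :
    Hoelder (fun p : (ℝ × ℝ) × ℝ => numeratorX l ψ x p.1.1 p.1.2 p.2) (numeratorBound C K)
      (1 / 2) := by
  refine (hψ.hoelder_sin (A := fun p : (ℝ × ℝ) × ℝ => !₂[p.1.1, p.1.2])
    (B := fun p => !₂[x, p.2]) (fun p q => ?_) (fun p q => ?_)).mul
    (hl.hoelder_l (a := fun p : (ℝ × ℝ) × ℝ => p.1.1 - x)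
      (b := fun p : (ℝ × ℝ) × ℝ => p.2 - p.1.2) (fun p q => ?_)
      (fun p q => ?_))
  all_goals obtain ⟨h1, h2, h3⟩ := abs_coord_sub_le p q
  · exact (norm_point_sub_le _ _ _ _).trans (by linarith)
  · refine (norm_point_sub_le _ _ _ _).trans ?_
    rw [sub_self, abs_zero]; linarith [abs_nonneg (p.2 - q.2)]
  · rw [sub_sub_sub_cancel_right]; linarith [abs_nonneg (p.1.1 - q.1.1)]
  · rw [sub_sub_sub_comm]
    exact (abs_sub _ _).trans (by linarith)

theorem hoelder_numeratorY (hψ : PhaseHoelder ψ C) (hl : LipschitzKernels k l K) (y : ℝ) :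
    Hoelder (fun p : (ℝ × ℝ) × ℝ => numeratorY l ψ y p.1.1 p.1.2 p.2) (numeratorBound C K)
      (1 / 2) := by
  refine (hψ.hoelder_sin (A := fun p : (ℝ × ℝ) × ℝ => !₂[p.1.1, p.1.2])
    (B := fun p => !₂[p.2, y]) (fun p q => ?_) (fun p q => ?_)).mul
    (hl.hoelder_l (a := fun p : (ℝ × ℝ) × ℝ => p.2 - p.1.1)
      (b := fun p : (ℝ × ℝ) × ℝ => p.1.2 - y) (fun p q => ?_)
      (fun p q => ?_))
  all_goals obtain ⟨h1, h2, h3⟩ := abs_coord_sub_le p q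
  · exact (norm_point_sub_le _ _ _ _).trans (by linarith)
  · refine (norm_point_sub_le _ _ _ _).trans ?_
    rw [sub_self, abs_zero]; linarith [abs_nonneg (p.2 - q.2)]
  · rw [sub_sub_sub_comm]
    exact (abs_sub _ _).trans (by linarith)
  · rw [sub_sub_sub_cancel_right]; linarith [abs_nonneg (p.1.2 - q.1.2)]

theorem LipschitzKernels.hoelder_k (hk : LipschitzKernels k l K) (c : ℝ) :
    Hoelder (fun t => k (t - c)) (2 + 4 * K) (1 / 2) := by
  have hK := hk.nonneg
  refine Hoelder.of_lipschitz (by positivity) (by norm_num) (by norm_num)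
    (fun q => hk.abs_k_le _) fun p q => (hk.abs_k_sub_le _ _).trans ?_
  rw [sub_sub_sub_cancel_right, Real.dist_eq]
  nlinarith [mul_nonneg hK (abs_nonneg (p - q))]

theorem hoelder_singleX (hψ : PhaseHoelder ψ C) (hk : LipschitzKernels k l K) (x y : ℝ) :
    Hoelder (fun t => Real.sin (ψ !₂[t, y] - ψ !₂[x, y]) * k (t - x)) (numeratorBound C K)
      (1 / 2) := by
  refine (hψ.hoelder_sin (A := fun t : ℝ => !₂[t, y]) (B := fun _ => !₂[x, y])
    (fun p q => ?_) (fun p q => ?_)).mul (hk.hoelder_k x)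
  · refine (norm_point_sub_le _ _ _ _).trans ?_
    rw [sub_self, abs_zero, Real.dist_eq]; linarith [abs_nonneg (p - q)]
  · rw [sub_self, norm_zero]; positivity

theorem hoelder_singleY (hψ : PhaseHoelder ψ C) (hk : LipschitzKernels k l K) (x y : ℝ) :
    Hoelder (fun t => Real.sin (ψ !₂[x, t] - ψ !₂[x, y]) * k (t - y)) (numeratorBound C K)
      (1 / 2) := by
  refine (hψ.hoelder_sin (A := fun t : ℝ => !₂[x, t]) (B := fun _ => !₂[x, y])
    (fun p q => ?_) (fun p q => ?_)).mul (hk.hoelder_k y)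
  · refine (norm_point_sub_le _ _ _ _).trans ?_
    rw [sub_self, abs_zero, Real.dist_eq]; linarith [abs_nonneg (p - q)]
  · rw [sub_self, norm_zero]; positivity

theorem LipschitzKernels.continuous_k (hk : LipschitzKernels k l K) : Continuous k := by
  simpa using (hk.hoelder_k 0).continuous (by norm_num)

theorem LipschitzKernels.continuous_l (hl : LipschitzKernels k l K) :
    Continuous fun p : ℝ × ℝ => l p.1 p.2 := by
  refine (hl.hoelder_l (Q := ℝ × ℝ) (a := Prod.fst) (b := Prod.snd) (fun p q => ?_)
    fun p q => ?_).continuous (by norm_num)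
  · have : |p.1 - q.1| ≤ dist p q := by simp [Prod.dist_eq, Real.dist_eq]
    linarith [abs_nonneg (p.1 - q.1)]
  · have : |p.2 - q.2| ≤ dist p q := by simp [Prod.dist_eq, Real.dist_eq]
    linarith [abs_nonneg (p.2 - q.2)]

end numerators

/-! ### Borders of the aperture -/

namespace Aperture

variable {D : ℝ} (Ω : Aperture D)

/-- The borders of the vertical line at abscissa `x`. -/
def borderX (x : ℝ) : Fin Ω.ny ⊕ Fin Ω.ny → ℝ := Sum.elim (Ω.yLo · x) (Ω.yHi · x)

/-- The borders of the horizontal line at height `y`. -/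
def borderY (y : ℝ) : Fin Ω.nx ⊕ Fin Ω.nx → ℝ := Sum.elim (Ω.xLo · y) (Ω.xHi · y)

theorem measurable_borderX (i : Fin Ω.ny ⊕ Fin Ω.ny) : Measurable (Ω.borderX · i) := by
  cases i with
  | inl j => exact Ω.measurable_yLo j
  | inr j => exact Ω.measurable_yHi j

theorem measurable_borderY (i : Fin Ω.nx ⊕ Fin Ω.nx) : Measurable (Ω.borderY · i) := by
  cases i with
  | inl j => exact Ω.measurable_xLo j
  | inr j => exact Ω.measurable_xHi j

/-- The point `z` is neither a border point of the vertical nor of the horizontal line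
through it. -/
def OffBorder (z : Plane) : Prop :=
  (∀ i, Ω.borderX (z 0) i ≠ z 1) ∧ ∀ i, Ω.borderY (z 1) i ≠ z 0

theorem ae_offBorder : ∀ᵐ z : Plane, Ω.OffBorder z :=
  (eventually_all.2 fun i => ae_ne_graph_left (Ω.measurable_borderX i)).and
    (eventually_all.2 fun i => ae_ne_graph_right (Ω.measurable_borderY i))

/-- The singular weight of the vertical line at its border. -/
noncomputable def weightX (x y : ℝ) : ℝ := 1 + ∑ i, |y - Ω.borderX x i| ^ (-(1 / 2) : ℝ)

/-- The singular weight of the horizontal line at its border. -/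
noncomputable def weightY (x y : ℝ) : ℝ := 1 + ∑ i, |x - Ω.borderY y i| ^ (-(1 / 2) : ℝ)

variable {Ω}

theorem OffBorder.exists_regular_lineX {z : Plane} (hz : Ω.OffBorder z) :
    ∃ d, Regular (Ω.lineX (z 0)) (D / 2) (z 1) d ∧ d ^ (-(1 / 2) : ℝ) ≤ Ω.weightX (z 0) (z 1) := by
  obtain ⟨d, h0, h1, h2, h3⟩ := exists_borderDist Finset.univ (Ω.borderX (z 0)) (z 1)
    fun i _ => hz.1 i
  exact ⟨d, regular_iUnion_Icc (fun i => Ω.le_yLo i _) (fun i => Ω.yHi_le i _) h0 h1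
    (fun i => h2 (Sum.inl i) (Finset.mem_univ _)) (fun i => h2 (Sum.inr i) (Finset.mem_univ _)), h3⟩

theorem OffBorder.exists_regular_lineY {z : Plane} (hz : Ω.OffBorder z) :
    ∃ d, Regular (Ω.lineY (z 1)) (D / 2) (z 0) d ∧ d ^ (-(1 / 2) : ℝ) ≤ Ω.weightY (z 0) (z 1) := by
  obtain ⟨d, h0, h1, h2, h3⟩ := exists_borderDist Finset.univ (Ω.borderY (z 1)) (z 0)
    fun i _ => hz.2 i
  exact ⟨d, regular_iUnion_Icc (fun i => Ω.le_xLo i _) (fun i => Ω.xHi_le i _) h0 h1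
    (fun i => h2 (Sum.inl i) (Finset.mem_univ _)) (fun i => h2 (Sum.inr i) (Finset.mem_univ _)), h3⟩

variable (Ω)

theorem measurableSet_lineX : MeasurableSet {p : ℝ × ℝ | p.2 ∈ Ω.lineX p.1} := by
  simp only [lineX, Set.mem_iUnion, Set.ofPred_exists]
  exact MeasurableSet.iUnion fun j =>
    (measurableSet_le ((Ω.measurable_yLo j).comp measurable_fst) measurable_snd).inter
      (measurableSet_le measurable_snd ((Ω.measurable_yHi j).comp measurable_fst))

theorem measurableSet_lineY : MeasurableSet {p : ℝ × ℝ | p.2 ∈ Ω.lineY p.1} := by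
  simp only [lineY, Set.mem_iUnion, Set.ofPred_exists]
  exact MeasurableSet.iUnion fun j =>
    (measurableSet_le ((Ω.measurable_xLo j).comp measurable_fst) measurable_snd).inter
      (measurableSet_le measurable_snd ((Ω.measurable_xHi j).comp measurable_fst))

end Aperture

/-! ### Existence of the principal values for a Hölder continuous phase -/

variable {D : ℝ} {Ω : Aperture D} {k : ℝ → ℝ} {l : ℝ → ℝ → ℝ} {φ ψ : Plane → ℝ} {C K : ℝ}

theorem pyramidXExists_of_phaseHoelder (hψ : PhaseHoelder ψ C) (hk : LipschitzKernels k l K)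
    {z : Plane} (hz : Ω.OffBorder z) : PyramidXExists Ω k l ψ z := by
  obtain ⟨d₁, h₁, -⟩ := hz.exists_regular_lineX
  obtain ⟨d₂, h₂, -⟩ := hz.exists_regular_lineY
  have hF := hoelder_numeratorX hψ hk (z 0)
  exact ⟨((hoelder_singleX hψ hk (z 0) (z 1)).hoelderAt (by norm_num) _).pvExists h₂ (by norm_num),
    Eventually.of_forall fun u => Eventually.of_forall fun v =>
      hF.iteratedInner_integrand_pvExists (by norm_num) h₁ u v,
    Eventually.of_forall fun u => hF.iteratedInner_pvExists (by norm_num) (by norm_num) h₁ h₁ u,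
    hF.iteratedMiddle_pvExists (by norm_num) (by norm_num) h₁ h₁ h₂⟩

theorem pyramidYExists_of_phaseHoelder (hψ : PhaseHoelder ψ C) (hk : LipschitzKernels k l K)
    {z : Plane} (hz : Ω.OffBorder z) : PyramidYExists Ω k l ψ z := by
  obtain ⟨d₁, h₁, -⟩ := hz.exists_regular_lineX
  obtain ⟨d₂, h₂, -⟩ := hz.exists_regular_lineY
  have hF := hoelder_numeratorY hψ hk (z 1)
  exact ⟨((hoelder_singleY hψ hk (z 0) (z 1)).hoelderAt (by norm_num) _).pvExists h₁ (by norm_num),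
    Eventually.of_forall fun u => Eventually.of_forall fun v =>
      hF.iteratedInner_integrand_pvExists (by norm_num) h₂ u v,
    Eventually.of_forall fun u => hF.iteratedInner_pvExists (by norm_num) (by norm_num) h₂ h₁ u,
    hF.iteratedMiddle_pvExists (by norm_num) (by norm_num) h₂ h₁ h₂⟩

/-! ### Independence of the representative -/

/-- The functions `φ` and `ψ` agree at `z`, almost everywhere on both lines through `z` and almost
everywhere in the plane. -/
structure AgreeAt (φ ψ : Plane → ℝ) (z : Plane) : Prop where
  point : φ !₂[z 0, z 1] = ψ !₂[z 0, z 1]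
  vertical : ∀ᵐ t, φ !₂[z 0, t] = ψ !₂[z 0, t]
  horizontal : ∀ᵐ t, φ !₂[t, z 1] = ψ !₂[t, z 1]
  plane : ∀ᵐ u, ∀ᵐ v, φ !₂[u, v] = ψ !₂[u, v]

theorem ae_agreeAt (h : φ =ᵐ[volume] ψ) : ∀ᵐ z, AgreeAt φ ψ z := by
  have h1 := ae_plane_of_ae_prod (P := fun x y => φ !₂[x, y] = ψ !₂[x, y])
    (measurePreserving_point.quasiMeasurePreserving.ae h)
  filter_upwards [h1, ae_abscissa (ae_ae_of_ae_plane h), ae_ordinate (ae_ae_of_ae_plane' h)]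
    with z hz1 hz2 hz3
  exact ⟨hz1, hz2, hz3, ae_ae_of_ae_plane h⟩

namespace AgreeAt

variable {z : Plane}

theorem singleX (h : AgreeAt φ ψ z) :
    ∀ᵐ t, PyramidSensor.singleX k φ (z 0) (z 1) t = PyramidSensor.singleX k ψ (z 0) (z 1) t :=
  h.horizontal.mono fun t ht => by rw [PyramidSensor.singleX, PyramidSensor.singleX, ht, h.point]

theorem singleY (h : AgreeAt φ ψ z) :
    ∀ᵐ t, PyramidSensor.singleY k φ (z 0) (z 1) t = PyramidSensor.singleY k ψ (z 0) (z 1) t :=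
  h.vertical.mono fun t ht => by rw [PyramidSensor.singleY, PyramidSensor.singleY, ht, h.point]

theorem numeratorX (h : AgreeAt φ ψ z) (l : ℝ → ℝ → ℝ) : ∀ᵐ u, ∀ᵐ v, ∀ᵐ t,
    PyramidSensor.numeratorX l φ (z 0) u v t = PyramidSensor.numeratorX l ψ (z 0) u v t :=
  h.plane.mono fun u hu => hu.mono fun v hv => h.vertical.mono fun t ht => by
    rw [PyramidSensor.numeratorX, PyramidSensor.numeratorX, ht, hv]

theorem numeratorY (h : AgreeAt φ ψ z) (l : ℝ → ℝ → ℝ) : ∀ᵐ u, ∀ᵐ v, ∀ᵐ t,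
    PyramidSensor.numeratorY l φ (z 1) u v t = PyramidSensor.numeratorY l ψ (z 1) u v t :=
  h.plane.mono fun u hu => hu.mono fun v hv => h.horizontal.mono fun t ht => by
    rw [PyramidSensor.numeratorY, PyramidSensor.numeratorY, ht, hv]

theorem pyramidX_eq (h : AgreeAt φ ψ z) : pyramidX Ω k l φ z = pyramidX Ω k l ψ z := by
  have h1 : pvIntegral (Ω.lineY (z 1)) (z 0) (middleX Ω l φ (z 0) (z 1))
      = pvIntegral (Ω.lineY (z 1)) (z 0) (middleX Ω l ψ (z 0) (z 1)) :=
    iteratedOuter_congr_ae (h.numeratorX l)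
  rw [pyramidX, pyramidX, pvIntegral_congr_ae h.singleX, h1]

theorem pyramidY_eq (h : AgreeAt φ ψ z) : pyramidY Ω k l φ z = pyramidY Ω k l ψ z := by
  have h1 : pvIntegral (Ω.lineY (z 1)) (z 0) (middleY Ω l φ (z 0) (z 1))
      = pvIntegral (Ω.lineY (z 1)) (z 0) (middleY Ω l ψ (z 0) (z 1)) :=
    iteratedOuter_congr_ae (h.numeratorY l)
  rw [pyramidY, pyramidY, pvIntegral_congr_ae h.singleY, h1]

theorem pyramidXExists (h : AgreeAt φ ψ z) (hψ : PyramidXExists Ω k l ψ z) :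
    PyramidXExists Ω k l φ z := by
  obtain ⟨h1, h2, h3, h4⟩ := hψ
  refine ⟨h1.congr_ae h.singleX, ?_, ?_, h4.congr_ae ?_⟩
  · filter_upwards [h2, ae_restrict_of_ae (h.numeratorX l)] with u hu hu'
    filter_upwards [hu, ae_restrict_of_ae hu'] with v hv hv'
    refine hv.congr_ae (hv'.mono fun t ht => ?_)
    exact congrArg (· / ((u - z 0) * (v - z 1) * (t - z 1))) ht
  · filter_upwards [h3, ae_restrict_of_ae (h.numeratorX l)] with u hu hu'
    exact hu.congr_ae (hu'.mono fun v hv =>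
        iteratedInner_congr_ae (S₁ := Ω.lineX (z 0)) (c₁ := z 1) (c₂ := z 1) (c₃ := z 0)
      (F := PyramidSensor.numeratorX l φ (z 0)) (G := PyramidSensor.numeratorX l ψ (z 0)) hv)
  · exact (h.numeratorX l).mono fun u hu =>
      iteratedMiddle_congr_ae (S₂ := Ω.lineX (z 0)) (S₁ := Ω.lineX (z 0))
        (c₁ := z 1) (c₂ := z 1) (c₃ := z 0)
      (F := PyramidSensor.numeratorX l φ (z 0)) (G := PyramidSensor.numeratorX l ψ (z 0)) hu

theorem pyramidYExists (h : AgreeAt φ ψ z) (hψ : PyramidYExists Ω k l ψ z) :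
    PyramidYExists Ω k l φ z := by
  obtain ⟨h1, h2, h3, h4⟩ := hψ
  refine ⟨h1.congr_ae h.singleY, ?_, ?_, h4.congr_ae ?_⟩
  · filter_upwards [h2, ae_restrict_of_ae (h.numeratorY l)] with u hu hu'
    filter_upwards [hu, ae_restrict_of_ae hu'] with v hv hv'
    refine hv.congr_ae (hv'.mono fun t ht => ?_)
    exact congrArg (· / ((u - z 0) * (v - z 1) * (t - z 0))) ht
  · filter_upwards [h3, ae_restrict_of_ae (h.numeratorY l)] with u hu hu'
    exact hu.congr_ae (hu'.mono fun v hv =>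
        iteratedInner_congr_ae (S₁ := Ω.lineY (z 1)) (c₁ := z 0) (c₂ := z 1) (c₃ := z 0)
      (F := PyramidSensor.numeratorY l φ (z 1)) (G := PyramidSensor.numeratorY l ψ (z 1)) hv)
  · exact (h.numeratorY l).mono fun u hu =>
      iteratedMiddle_congr_ae (S₂ := Ω.lineX (z 0)) (S₁ := Ω.lineY (z 1))
        (c₁ := z 0) (c₂ := z 1) (c₃ := z 0)
      (F := PyramidSensor.numeratorY l φ (z 1)) (G := PyramidSensor.numeratorY l ψ (z 1)) hu

end AgreeAt

/-! ### Measurability of the sensor data -/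

theorem measurable_coord (i : Fin 2) : Measurable fun z : Plane => z i := by fun_prop

theorem measurable_point {W : Type*} [MeasurableSpace W] {a b : W → ℝ} (ha : Measurable a)
    (hb : Measurable b) : Measurable fun w => (!₂[a w, b w] : Plane) :=
  measurePreserving_point.measurable.comp (ha.prodMk hb)

theorem Aperture.measurableSet_plane_lineX (Ω : Aperture D) :
    MeasurableSet {p : Plane × ℝ | p.2 ∈ Ω.lineX (p.1 0)} :=
  Ω.measurableSet_lineX.preimage (f := fun p : Plane × ℝ => (p.1 0, p.2))
    (((measurable_coord 0).comp measurable_fst).prodMk measurable_snd)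

theorem Aperture.measurableSet_plane_lineY (Ω : Aperture D) :
    MeasurableSet {p : Plane × ℝ | p.2 ∈ Ω.lineY (p.1 1)} :=
  Ω.measurableSet_lineY.preimage (f := fun p : Plane × ℝ => (p.1 1, p.2))
    (((measurable_coord 1).comp measurable_fst).prodMk measurable_snd)

theorem Aperture.measurableSet_mem_lineX (Ω : Aperture D) :
    MeasurableSet {z : Plane | z 1 ∈ Ω.lineX (z 0)} :=
  Ω.measurableSet_lineX.preimage (f := fun z : Plane => (z 0, z 1))
    ((measurable_coord 0).prodMk (measurable_coord 1))

theorem Aperture.measurableSet_mem_lineY (Ω : Aperture D) :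
    MeasurableSet {z : Plane | z 0 ∈ Ω.lineY (z 1)} :=
  Ω.measurableSet_lineY.preimage (f := fun z : Plane => (z 1, z 0))
    ((measurable_coord 1).prodMk (measurable_coord 0))

theorem aestronglyMeasurable_pyramidX (hψ : PhaseHoelder ψ C) (hk : LipschitzKernels k l K) :
    AEStronglyMeasurable (pyramidX Ω k l ψ) volume := by
  have hψm := hψ.continuous.measurable
  have hkm := hk.continuous_k.measurable
  have hlm := hk.continuous_l.measurable
  have m0 := measurable_coord 0
  have m1 := measurable_coord 1
  have hsingle : AEStronglyMeasurable (fun z : Plane =>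
      pvIntegral (Ω.lineY (z 1)) (z 0) (singleX k ψ (z 0) (z 1))) volume := by
    have hm : Measurable fun p : Plane × ℝ => singleX k ψ (p.1 0) (p.1 1) p.2 :=
      ((Real.measurable_sin.comp ((hψm.comp (measurable_point measurable_snd
        (m1.comp measurable_fst))).sub (hψm.comp (measurable_point (m0.comp measurable_fst)
        (m1.comp measurable_fst))))).mul
          (hkm.comp (measurable_snd.sub (m0.comp measurable_fst)))).div
        (measurable_snd.sub (m0.comp measurable_fst))
    refine (measurable_pvSeq (S := fun z : Plane => Ω.lineY (z 1))
      (f := fun z : Plane => singleX k ψ (z 0) (z 1))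
      Ω.measurableSet_plane_lineY m0 hm).aestronglyMeasurable.congr ?_
    filter_upwards [Ω.ae_offBorder] with z hz
    exact (pyramidXExists_of_phaseHoelder hψ hk hz).1.pvIntegral_eq_pvSeq.symm
  have htriple : AEStronglyMeasurable (fun z : Plane =>
      pvIntegral (Ω.lineY (z 1)) (z 0) (middleX Ω l ψ (z 0) (z 1))) volume := by
    refine aestronglyMeasurable_iteratedOuter (F := fun z : Plane => numeratorX l ψ (z 0))
      Ω.measurableSet_plane_lineX Ω.measurableSet_plane_lineX Ω.measurableSet_plane_lineY
      m1 m1 m0 ?_ ?_ ?_ ?_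
    · have a0 : Measurable fun p : ((Plane × ℝ) × ℝ) × ℝ => p.1.1.1 0 := m0.comp (by fun_prop)
      have a1 : Measurable fun p : ((Plane × ℝ) × ℝ) × ℝ => p.1.1.2 := by fun_prop
      have a2 : Measurable fun p : ((Plane × ℝ) × ℝ) × ℝ => p.1.2 := by fun_prop
      have a3 : Measurable fun p : ((Plane × ℝ) × ℝ) × ℝ => p.2 := by fun_prop
      exact (Real.measurable_sin.comp ((hψm.comp (measurable_point a1 a2)).sub
        (hψm.comp (measurable_point a0 a3)))).mul
        (hlm.comp ((a1.sub a0).prodMk (a3.sub a2)))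
    · filter_upwards [Ω.ae_offBorder] with z hz u v
      obtain ⟨d₁, h₁, -⟩ := hz.exists_regular_lineX
      exact (hoelder_numeratorX hψ hk (z 0)).iteratedInner_integrand_pvExists (by norm_num) h₁ u v
    · filter_upwards [Ω.ae_offBorder] with z hz u
      obtain ⟨d₁, h₁, -⟩ := hz.exists_regular_lineX
      exact (hoelder_numeratorX hψ hk (z 0)).iteratedInner_pvExists (by norm_num) (by norm_num)
        h₁ h₁ u
    · filter_upwards [Ω.ae_offBorder] with z hz
      exact (pyramidXExists_of_phaseHoelder hψ hk hz).2.2.2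
  have hregion : AEStronglyMeasurable (fun z => Ω.region.indicator (1 : Plane → ℝ) z) volume :=
    (measurable_one.indicator
      (Ω.measurableSet_mem_lineY.inter Ω.measurableSet_mem_lineX)).aestronglyMeasurable
  have hline : AEStronglyMeasurable (fun z : Plane =>
      (Ω.lineY (z 1)).indicator (1 : ℝ → ℝ) (z 0)) volume :=
    (measurable_one.indicator Ω.measurableSet_mem_lineY).aestronglyMeasurable
  exact ((aestronglyMeasurable_const.mul hregion).mul hsingle).add
    ((aestronglyMeasurable_const.mul hline).mul htriple)

theorem aestronglyMeasurable_pyramidY (hψ : PhaseHoelder ψ C) (hk : LipschitzKernels k l K) :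
    AEStronglyMeasurable (pyramidY Ω k l ψ) volume := by
  have hψm := hψ.continuous.measurable
  have hkm := hk.continuous_k.measurable
  have hlm := hk.continuous_l.measurable
  have m0 := measurable_coord 0
  have m1 := measurable_coord 1
  have hsingle : AEStronglyMeasurable (fun z : Plane =>
      pvIntegral (Ω.lineX (z 0)) (z 1) (singleY k ψ (z 0) (z 1))) volume := by
    have hm : Measurable fun p : Plane × ℝ => singleY k ψ (p.1 0) (p.1 1) p.2 :=
      ((Real.measurable_sin.comp ((hψm.comp (measurable_point (m0.comp measurable_fst)
        measurable_snd)).sub (hψm.comp (measurable_point (m0.comp measurable_fst)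
        (m1.comp measurable_fst))))).mul
          (hkm.comp (measurable_snd.sub (m1.comp measurable_fst)))).div
        (measurable_snd.sub (m1.comp measurable_fst))
    refine (measurable_pvSeq (S := fun z : Plane => Ω.lineX (z 0))
      (f := fun z : Plane => singleY k ψ (z 0) (z 1))
      Ω.measurableSet_plane_lineX m1 hm).aestronglyMeasurable.congr ?_
    filter_upwards [Ω.ae_offBorder] with z hz
    exact (pyramidYExists_of_phaseHoelder hψ hk hz).1.pvIntegral_eq_pvSeq.symm
  have htriple : AEStronglyMeasurable (fun z : Plane =>
      pvIntegral (Ω.lineY (z 1)) (z 0) (middleY Ω l ψ (z 0) (z 1))) volume := by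
    refine aestronglyMeasurable_iteratedOuter (F := fun z : Plane => numeratorY l ψ (z 1))
      Ω.measurableSet_plane_lineY Ω.measurableSet_plane_lineX Ω.measurableSet_plane_lineY
      m0 m1 m0 ?_ ?_ ?_ ?_
    · have a0 : Measurable fun p : ((Plane × ℝ) × ℝ) × ℝ => p.1.1.1 1 := m1.comp (by fun_prop)
      have a1 : Measurable fun p : ((Plane × ℝ) × ℝ) × ℝ => p.1.1.2 := by fun_prop
      have a2 : Measurable fun p : ((Plane × ℝ) × ℝ) × ℝ => p.1.2 := by fun_prop
      have a3 : Measurable fun p : ((Plane × ℝ) × ℝ) × ℝ => p.2 := by fun_prop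
      exact (Real.measurable_sin.comp ((hψm.comp (measurable_point a1 a2)).sub
        (hψm.comp (measurable_point a3 a0)))).mul
        (hlm.comp ((a3.sub a1).prodMk (a2.sub a0)))
    · filter_upwards [Ω.ae_offBorder] with z hz u v
      obtain ⟨d₂, h₂, -⟩ := hz.exists_regular_lineY
      exact (hoelder_numeratorY hψ hk (z 1)).iteratedInner_integrand_pvExists (by norm_num) h₂ u v
    · filter_upwards [Ω.ae_offBorder] with z hz u
      obtain ⟨d₁, h₁, -⟩ := hz.exists_regular_lineX
      obtain ⟨d₂, h₂, -⟩ := hz.exists_regular_lineY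
      exact (hoelder_numeratorY hψ hk (z 1)).iteratedInner_pvExists (by norm_num) (by norm_num)
        h₂ h₁ u
    · filter_upwards [Ω.ae_offBorder] with z hz
      exact (pyramidYExists_of_phaseHoelder hψ hk hz).2.2.2
  have hregion : AEStronglyMeasurable (fun z => Ω.region.indicator (1 : Plane → ℝ) z) volume :=
    (measurable_one.indicator
      (Ω.measurableSet_mem_lineY.inter Ω.measurableSet_mem_lineX)).aestronglyMeasurable
  have hline : AEStronglyMeasurable (fun z : Plane =>
      (Ω.lineX (z 0)).indicator (1 : ℝ → ℝ) (z 1)) volume :=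
    (measurable_one.indicator Ω.measurableSet_mem_lineX).aestronglyMeasurable
  exact ((aestronglyMeasurable_const.mul hregion).mul hsingle).add
    ((aestronglyMeasurable_const.mul hline).mul htriple)

/-! ### Pointwise bounds -/

theorem Regular.rpow_neg_mul_kernelMass_le {S : Set ℝ} {R c d ε : ℝ} (hS : Regular S R c d)
    (hR : 0 ≤ R) (h0 : 0 < ε) (h1 : ε < 1) :
    d ^ (-ε) * kernelMass ε S c ≤
      (1 + R) * (localMass ε + 4 * R) * (d ^ (-ε) * (1 + |c|) ^ (ε - 1)) := by
  have := mul_le_mul_of_nonneg_left (kernelMass_le hR h0 h1 hS.measurableSet hS.subset_Icc c)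
    (Real.rpow_nonneg hS.pos.le (-ε))
  linarith

/-- The constant in the pointwise bound of the sensor data. -/
noncomputable def dataBound (N R ε : ℝ) : ℝ :=
  N * ((1 + R) * (localMass ε + 4 * R)) * (1 + R) ^ 2
    + 4 * N * ((1 + R) * (localMass ε + 4 * R)) ^ 3

/-- Bound for a value `i q / π + j t / π³` of the sensor data. For `P_x` one has `c = y`, `c' = x`, `S`
and `S'` are the vertical and the horizontal line, `i` and `j` the values of the two characteristic
functions, `q` the single and `t` the triple integral; for `P_y` the coordinates are interchanged.
The point need not be bounded in the direction of `c`, but two of the three iterated integrals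
are taken there, which gives the decay of order `2 (ε - 1)`. -/
theorem abs_data_le {S S' : Set ℝ} {R c d c' d' ε N i j q t : ℝ}
    (hS : Regular S R c d) (hS' : Regular S' R c' d') (hR : 0 ≤ R) (hN : 0 ≤ N)
    (h0 : 0 < ε) (h1 : ε < 1)
    (hi0 : 0 ≤ i) (hi1 : i ≤ 1) (hi : i ≠ 0 → |c| ≤ R ∧ |c'| ≤ R)
    (hj0 : 0 ≤ j) (hj1 : j ≤ 1) (hj : j ≠ 0 → |c'| ≤ R)
    (hq : |q| ≤ N * (d' ^ (-ε) * kernelMass ε S' c'))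
    (ht : |t| ≤ 4 * N * (d ^ (-ε) * kernelMass ε S c) ^ 2 * (d' ^ (-ε) * kernelMass ε S' c')) :
    |1 / Real.pi * i * q + 1 / Real.pi ^ 3 * j * t| ≤ dataBound N R ε *
      ((Set.Icc (-R) R).indicator 1 c' *
        ((1 + |c|) ^ (2 * (ε - 1)) * (d ^ (-(2 * ε)) * d' ^ (-ε)))) := by
  set B := (1 + R) * (localMass ε + 4 * R) with hB
  have hB0 : 0 ≤ B := by have := localMass_nonneg ε; positivity
  have hpi : 1 / Real.pi ≤ 1 := by
    rw [div_le_one Real.pi_pos]; linarith [Real.pi_gt_three]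
  have hpi3 : 1 / Real.pi ^ 3 ≤ 1 := by
    rw [div_le_one (by positivity)]; exact one_le_pow₀ (by linarith [Real.pi_gt_three])
  have hpi0 : 0 ≤ 1 / Real.pi := by positivity
  have hpi30 : 0 ≤ 1 / Real.pi ^ 3 := by positivity
  have hd := hS.pos
  have hd' := hS'.pos
  have hc1 : 1 ≤ 1 + |c| := by linarith [abs_nonneg c]
  have hc1' : (1 + |c'|) ^ (ε - 1) ≤ 1 :=
    Real.rpow_le_one_of_one_le_of_nonpos (by linarith [abs_nonneg c']) (by linarith)
  have hX' : 0 ≤ d' ^ (-ε) := by positivity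
  have hX : 1 ≤ d ^ (-(2 * ε)) :=
    Real.one_le_rpow_of_pos_of_le_one_of_nonpos hd hS.le_one (by linarith)
  have hW := hS.rpow_neg_mul_kernelMass_le hR h0 h1
  have hW' : d' ^ (-ε) * kernelMass ε S' c' ≤ B * d' ^ (-ε) := by
    refine (hS'.rpow_neg_mul_kernelMass_le hR h0 h1).trans ?_
    rw [← hB]
    gcongr
    exact mul_le_of_le_one_right hX' hc1'
  have hW0 : 0 ≤ d ^ (-ε) * kernelMass ε S c :=
    mul_nonneg (by positivity) (kernelMass_nonneg _ _ _)
  have hW0' : 0 ≤ d' ^ (-ε) * kernelMass ε S' c' :=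
    mul_nonneg (by positivity) (kernelMass_nonneg _ _ _)
  have hW2 : (d ^ (-ε) * kernelMass ε S c) ^ 2
      ≤ B ^ 2 * (d ^ (-(2 * ε)) * (1 + |c|) ^ (2 * (ε - 1))) := by
    calc _ ≤ (B * (d ^ (-ε) * (1 + |c|) ^ (ε - 1))) ^ 2 := by gcongr
      _ = B ^ 2 * ((d ^ (-ε)) ^ 2 * ((1 + |c|) ^ (ε - 1)) ^ 2) := by ring
      _ = _ := by
        rw [← Real.rpow_mul_natCast hd.le, ← Real.rpow_mul_natCast (by linarith)]
        congr 3 <;> push_cast <;> ring_nf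
  set P := d ^ (-(2 * ε)) with hP
  set P' := d' ^ (-ε) with hP'
  set Q := (1 + |c|) ^ (2 * (ε - 1)) with hQ
  have hQ0 : 0 ≤ Q := by positivity
  have ht' : |t| ≤ 4 * N * B ^ 3 * (Q * (P * P')) := by
    refine ht.trans ?_
    calc _ ≤ 4 * N * (B ^ 2 * (P * Q)) * (B * P') := by gcongr
      _ = _ := by ring
  have hq' : |c| ≤ R → |q| ≤ N * B * (1 + R) ^ 2 * (Q * (P * P')) := by
    intro hcR
    -- Within the aperture the decaying factor is bounded below.
    have hQ1 : 1 ≤ (1 + R) ^ 2 * Q := by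
      have e : (1 + |c|) ^ 2 * (1 + |c|) ^ (2 * (ε - 1)) = (1 + |c|) ^ (2 * ε) := by
        rw [← Real.rpow_natCast, ← Real.rpow_add (by linarith)]
        congr 1; push_cast; ring
      calc 1 ≤ (1 + |c|) ^ (2 * ε) := Real.one_le_rpow hc1 (by linarith)
        _ = (1 + |c|) ^ 2 * Q := e.symm
        _ ≤ _ := by gcongr
    calc |q| ≤ N * (B * P') := hq.trans (by gcongr)
      _ = N * B * P' * (1 * 1) := by ring
      _ ≤ N * B * P' * (((1 + R) ^ 2 * Q) * P) := by gcongr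
      _ = _ := by ring
  by_cases hc' : |c'| ≤ R
  · rw [Set.indicator_of_mem (Set.mem_Icc.2 (abs_le.1 hc')), Pi.one_apply, one_mul,
    dataBound, add_mul]
    refine (abs_add_le _ _).trans (add_le_add ?_ ?_)
    · rcases eq_or_ne i 0 with h | h
      · rw [h, mul_zero, zero_mul, abs_zero]; positivity
      · rw [abs_mul, abs_of_nonneg (mul_nonneg hpi0 hi0)]
        refine (mul_le_of_le_one_left (abs_nonneg _) ?_).trans (hq' (hi h).1)
        exact mul_le_one₀ hpi hi0 hi1
    · rw [abs_mul, abs_of_nonneg (mul_nonneg hpi30 hj0)]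
      refine (mul_le_of_le_one_left (abs_nonneg _) ?_).trans ht'
      exact mul_le_one₀ hpi3 hj0 hj1
  · have hi' : i = 0 := by by_contra h; exact hc' (hi h).2
    have hj' : j = 0 := by by_contra h; exact hc' (hj h)
    rw [hi', hj', Set.indicator_of_notMem (s := Set.Icc (-R) R) (fun h => hc' (abs_le.2 h))]
    simp

/-- The choice `ε = 1 / (8 p)` reduces the `p`-th power of the bound in `abs_data_le` to inverse
square roots of the distances to the borders. -/
theorem rpow_bound_le {p s d d' w w' : ℝ} (hp : 1 ≤ p) (hs : 0 ≤ s) (hd : 0 < d)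
    (hd' : 0 < d') (hd1' : d' ≤ 1) (hw : d ^ (-(1 / 2) : ℝ) ≤ w) (hw' : d' ^ (-(1 / 2) : ℝ) ≤ w') :
    ((1 + s) ^ (2 * (1 / (8 * p) - 1)) * (d ^ (-(2 * (1 / (8 * p)))) * d' ^ (-(1 / (8 * p))))) ^ p
      ≤ (1 + s) ^ (-(3 / 2) : ℝ) * (w + w') := by
  have hp0 : 0 < p := by linarith
  rw [Real.mul_rpow (by positivity) (by positivity), Real.mul_rpow (by positivity) (by positivity),
    ← Real.rpow_mul (by linarith), ← Real.rpow_mul hd.le, ← Real.rpow_mul hd'.le]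
  have e1 : 2 * (1 / (8 * p) - 1) * p = 1 / 4 - 2 * p := by field_simp; ring
  have e2 : -(2 * (1 / (8 * p))) * p = -(1 / 4) := by field_simp; norm_num
  have e3 : -(1 / (8 * p)) * p = -(1 / 8) := by field_simp
  rw [e1, e2, e3]
  have h1 : (1 + s) ^ (1 / 4 - 2 * p) ≤ (1 + s) ^ (-(3 / 2) : ℝ) :=
    Real.rpow_le_rpow_of_exponent_le (by linarith) (by linarith)
  have h2 : d' ^ (-(1 / 8) : ℝ) ≤ d' ^ (-(1 / 4) : ℝ) :=
    Real.rpow_le_rpow_of_exponent_ge hd' hd1' (by norm_num)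
  have hsq : ∀ a : ℝ, 0 < a → a ^ (-(1 / 4) : ℝ) * a ^ (-(1 / 4) : ℝ) = a ^ (-(1 / 2) : ℝ) :=
    fun a ha => by rw [← Real.rpow_add ha]; norm_num
  have h3 : d ^ (-(1 / 4) : ℝ) * d' ^ (-(1 / 8) : ℝ) ≤ w + w' := by
    have ha : 0 ≤ d ^ (-(1 / 4) : ℝ) := by positivity
    have hb : 0 ≤ d' ^ (-(1 / 4) : ℝ) := by positivity
    calc _ ≤ d ^ (-(1 / 4) : ℝ) * d' ^ (-(1 / 4) : ℝ) := by gcongr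
      _ ≤ d ^ (-(1 / 4) : ℝ) * d ^ (-(1 / 4) : ℝ) + d' ^ (-(1 / 4) : ℝ) * d' ^ (-(1 / 4) : ℝ) := by
        nlinarith [sq_nonneg (d ^ (-(1 / 4) : ℝ) - d' ^ (-(1 / 4) : ℝ)), mul_nonneg ha hb]
      _ ≤ w + w' := by rw [hsq d hd, hsq d' hd']; linarith
  gcongr

theorem indicator_one_mem {α : Type*} (s : Set α) (a : α) :
    0 ≤ s.indicator (1 : α → ℝ) a ∧ s.indicator (1 : α → ℝ) a ≤ 1 := by
  by_cases h : a ∈ s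
  · rw [Set.indicator_of_mem h]; simp
  · rw [Set.indicator_of_notMem h]; simp

theorem abs_data_rpow_le {S S' : Set ℝ} {R c d c' d' w w' p N i j q t : ℝ}
    (hS : Regular S R c d) (hS' : Regular S' R c' d') (hR : 0 ≤ R) (hN : 0 ≤ N) (hp : 1 ≤ p)
    (hw : d ^ (-(1 / 2) : ℝ) ≤ w) (hw' : d' ^ (-(1 / 2) : ℝ) ≤ w')
    (hi01 : 0 ≤ i ∧ i ≤ 1) (hi : i ≠ 0 → c ∈ S ∧ c' ∈ S')
    (hj01 : 0 ≤ j ∧ j ≤ 1) (hj : j ≠ 0 → c' ∈ S')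
    (hq : |q| ≤ N * (d' ^ (-(1 / (8 * p))) * kernelMass (1 / (8 * p)) S' c'))
    (ht : |t| ≤ 4 * N * (d ^ (-(1 / (8 * p))) * kernelMass (1 / (8 * p)) S c) ^ 2 *
      (d' ^ (-(1 / (8 * p))) * kernelMass (1 / (8 * p)) S' c')) :
    |1 / Real.pi * i * q + 1 / Real.pi ^ 3 * j * t| ^ p ≤ dataBound N R (1 / (8 * p)) ^ p *
      ((Set.Icc (-R) R).indicator 1 c' * ((1 + |c|) ^ (-(3 / 2) : ℝ) * (w + w'))) := by
  have hp0 : 0 < p := by linarith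
  have hε1 : 1 / (8 * p) < 1 := by rw [div_lt_one (by positivity)]; linarith
  have hdata := abs_data_le hS hS' hR hN (by positivity) hε1 hi01.1 hi01.2
    (fun h => ⟨abs_le.2 (hS.subset_Icc (hi h).1), abs_le.2 (hS'.subset_Icc (hi h).2)⟩)
    hj01.1 hj01.2 (fun h => abs_le.2 (hS'.subset_Icc (hj h))) hq ht
  have hd := hS.pos
  have hd' := hS'.pos
  have hK0 : 0 ≤ dataBound N R (1 / (8 * p)) := by
    have := localMass_nonneg (1 / (8 * p))
    unfold dataBound; positivity
  set I : ℝ := (Set.Icc (-R) R).indicator 1 c' with hI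
  have hI0 : 0 ≤ I := (indicator_one_mem _ _).1
  have hI1 : I ^ p ≤ I := by
    by_cases h : c' ∈ Set.Icc (-R) R
    · rw [hI, Set.indicator_of_mem h, Pi.one_apply, Real.one_rpow]
    · rw [hI, Set.indicator_of_notMem h, Real.zero_rpow hp0.ne']
  refine (Real.rpow_le_rpow (abs_nonneg _) hdata hp0.le).trans ?_
  rw [Real.mul_rpow hK0 (by positivity), Real.mul_rpow hI0 (by positivity)]
  gcongr
  exact rpow_bound_le hp (abs_nonneg c) hd hd' hS'.le_one hw hw'

/-! ### Integrability of the dominating function -/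

/-- The singularity along the graph of `e` is integrable uniformly in the position of `e x`. -/
theorem integrable_mul_abs_sub_rpow {u v e : ℝ → ℝ} (hu : Integrable u) (hum : Measurable u)
    (hu0 : ∀ x, 0 ≤ u x) (hv : Integrable v) (hvm : Measurable v) (hv0 : ∀ y, 0 ≤ v y)
    (hv1 : ∀ y, v y ≤ 1) (he : Measurable e) :
    Integrable (fun p : ℝ × ℝ => u p.1 * v p.2 * |p.2 - e p.1| ^ (-(1 / 2) : ℝ)) := by
  have hmeas : Measurable (fun p : ℝ × ℝ => u p.1 * v p.2 * |p.2 - e p.1| ^ (-(1 / 2) : ℝ)) := by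
    fun_prop
  set loc : ℝ → ℝ := (Set.Icc (-1 : ℝ) 1).indicator (fun s => |s| ^ ((1 / 2 : ℝ) - 1)) with hloc
  have hbound : ∀ x y, u x * v y * |y - e x| ^ (-(1 / 2) : ℝ) ≤ u x * (loc (y - e x) + v y) := by
    intro x y
    have h1 := abs_rpow_le_localKernel_add_one (ε := 1 / 2) (by norm_num) (y - e x)
    rw [← hloc] at h1
    have h2 : 0 ≤ loc (y - e x) := Set.indicator_nonneg (fun s _ => by positivity) _
    rw [mul_assoc]
    refine mul_le_mul_of_nonneg_left ?_ (hu0 x)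
    have e1 : (-(1 / 2) : ℝ) = 1 / 2 - 1 := by norm_num
    rw [e1]
    calc _ ≤ v y * (loc (y - e x) + 1) := by gcongr; exact hv0 y
      _ ≤ _ := by nlinarith [hv0 y, hv1 y]
  have hdom : ∀ x, Integrable fun y => u x * (loc (y - e x) + v y) := fun x =>
    ((integrable_localKernel (by norm_num) (e x)).add hv).const_mul _
  have hnonneg : ∀ x y, 0 ≤ u x * v y * |y - e x| ^ (-(1 / 2) : ℝ) := fun x y => by
    have := hu0 x; have := hv0 y; positivity
  have hint : ∀ x, Integrable fun y => u x * v y * |y - e x| ^ (-(1 / 2) : ℝ) := fun x => by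
    refine (hdom x).mono' (hmeas.comp measurable_prodMk_left).aestronglyMeasurable
      (Eventually.of_forall fun y => ?_)
    rw [Real.norm_of_nonneg (hnonneg x y)]
    exact hbound x y
  refine (integrable_prod_iff hmeas.aestronglyMeasurable).2 ⟨Eventually.of_forall hint, ?_⟩
  refine (hu.mul_const (localMass (1 / 2) + ∫ y, v y)).mono'
    (hmeas.aestronglyMeasurable.norm.integral_prod_right') (Eventually.of_forall fun x => ?_)
  rw [Real.norm_of_nonneg (integral_nonneg fun _ => norm_nonneg _)]
  calc ∫ y, ‖u x * v y * |y - e x| ^ (-(1 / 2) : ℝ)‖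
      = ∫ y, u x * v y * |y - e x| ^ (-(1 / 2) : ℝ) := by
        congr 1; funext y; exact Real.norm_of_nonneg (hnonneg x y)
    _ ≤ ∫ y, u x * (loc (y - e x) + v y) := integral_mono (hint x) (hdom x) (hbound x)
    _ = u x * (localMass (1 / 2) + ∫ y, v y) := by
        rw [integral_const_mul, integral_add (integrable_localKernel (by norm_num) (e x)) hv,
          integral_localKernel]

theorem integrable_mul_abs_sub_rpow' {u v e : ℝ → ℝ} (hu : Integrable u) (hum : Measurable u)
    (hu0 : ∀ x, 0 ≤ u x) (hu1 : ∀ x, u x ≤ 1) (hv : Integrable v) (hvm : Measurable v)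
    (hv0 : ∀ y, 0 ≤ v y) (he : Measurable e) :
    Integrable (fun p : ℝ × ℝ => u p.1 * v p.2 * |p.1 - e p.2| ^ (-(1 / 2) : ℝ)) := by
  have := (integrable_mul_abs_sub_rpow hv hvm hv0 hu hum hu0 hu1 he).swap
  refine this.congr (Eventually.of_forall fun p => ?_)
  simp only [Function.comp_apply, Prod.fst_swap, Prod.snd_swap]
  ring

theorem Aperture.integrable_weights (Ω : Aperture D) {u v : ℝ → ℝ} (hu : Integrable u)
    (hum : Measurable u) (hu0 : ∀ x, 0 ≤ u x) (hu1 : ∀ x, u x ≤ 1) (hv : Integrable v)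
    (hvm : Measurable v) (hv0 : ∀ y, 0 ≤ v y) (hv1 : ∀ y, v y ≤ 1) :
    Integrable fun z : Plane =>
      u (z 0) * v (z 1) * (Ω.weightX (z 0) (z 1) + Ω.weightY (z 0) (z 1)) := by
  have h : Integrable fun p : ℝ × ℝ =>
      u p.1 * v p.2 * (Ω.weightX p.1 p.2 + Ω.weightY p.1 p.2) := by
    have h1 : Integrable fun p : ℝ × ℝ => u p.1 * v p.2 := hu.mul_prod hv
    have h2 : Integrable fun p : ℝ × ℝ =>
        ∑ i, u p.1 * v p.2 * |p.2 - Ω.borderX p.1 i| ^ (-(1 / 2) : ℝ) :=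
      integrable_finsetSum _ fun i _ =>
        integrable_mul_abs_sub_rpow (e := fun x => Ω.borderX x i)
            hu hum hu0 hv hvm hv0 hv1 (Ω.measurable_borderX i)
    have h3 : Integrable fun p : ℝ × ℝ =>
        ∑ i, u p.1 * v p.2 * |p.1 - Ω.borderY p.2 i| ^ (-(1 / 2) : ℝ) :=
      integrable_finsetSum _ fun i _ =>
        integrable_mul_abs_sub_rpow' (e := fun y => Ω.borderY y i)
            hu hum hu0 hu1 hv hvm hv0 (Ω.measurable_borderY i)
    refine ((h1.add h2).add (h1.add h3)).congr (Eventually.of_forall fun p => ?_)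
    simp only [Pi.add_apply, Aperture.weightX, Aperture.weightY, ← Finset.mul_sum]
    ring
  exact measurePreserving_coords.integrable_comp_of_integrable h

theorem integrable_one_add_abs_rpow : Integrable fun y : ℝ => (1 + |y|) ^ (-(3 / 2) : ℝ) := by
  have := integrable_one_add_norm (E := ℝ) (μ := volume) (r := 3 / 2) (by simp; norm_num)
  simpa only [Real.norm_eq_abs] using this

/-! ### The sensor data in Lebesgue spaces -/

theorem memLp_of_rpow_le {f g : Plane → ℝ} {p : ℝ≥0∞} (hp : 1 ≤ p) (hp' : p < ∞)
    (hf : AEStronglyMeasurable f volume) (hg : Integrable g)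
    (h : ∀ᵐ z, |f z| ^ p.toReal ≤ g z) : MemLp f p volume := by
  rw [← integrable_norm_rpow_iff hf (by positivity) hp'.ne]
  refine hg.mono' (hf.norm.aemeasurable.pow_const _).aestronglyMeasurable (h.mono fun z hz => ?_)
  rwa [Real.norm_of_nonneg (by positivity), Real.norm_eq_abs]

theorem integrable_indicator_Icc (R : ℝ) :
    Integrable ((Set.Icc (-R) R).indicator (1 : ℝ → ℝ)) :=
  (integrable_indicator_iff measurableSet_Icc).2 (integrableOn_const measure_Icc_lt_top.ne)

theorem memLp_pyramidX (hD : 0 ≤ D) (hψ : PhaseHoelder ψ C) (hk : LipschitzKernels k l K)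
    {p : ℝ≥0∞} (hp : 1 ≤ p) (hp' : p < ∞) : MemLp (pyramidX Ω k l ψ) p volume := by
  have hP1 : 1 ≤ p.toReal := by
    rw [← ENNReal.toReal_one]; exact ENNReal.toReal_mono hp'.ne hp
  have hN : 0 ≤ numeratorBound C K := by
    have := hψ.1; have := hk.nonneg
    simp only [numeratorBound]; positivity
  set ε := 1 / (8 * p.toReal) with hε
  have hε0 : 0 < ε := by positivity
  have hε8 : ε ≤ 1 / 8 := by rw [hε]; gcongr; linarith
  have hint := Ω.integrable_weights (integrable_indicator_Icc (D / 2))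
    (measurable_one.indicator measurableSet_Icc)
    (fun x => (indicator_one_mem _ x).1) (fun x => (indicator_one_mem _ x).2)
    integrable_one_add_abs_rpow (by fun_prop) (fun y => by positivity)
    (fun y => Real.rpow_le_one_of_one_le_of_nonpos (by linarith [abs_nonneg y]) (by norm_num))
  refine memLp_of_rpow_le hp hp' (aestronglyMeasurable_pyramidX hψ hk)
    (hint.const_mul (dataBound (numeratorBound C K) (D / 2) ε ^ p.toReal)) ?_
  filter_upwards [Ω.ae_offBorder] with z hz
  obtain ⟨d₁, h₁, hw₁⟩ := hz.exists_regular_lineX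
  obtain ⟨d₂, h₂, hw₂⟩ := hz.exists_regular_lineY
  have hsingle := ((hoelder_singleX hψ hk (z 0) (z 1)).hoelderAt (by norm_num) _).abs_pvIntegral_le
    h₂ hε0 (by linarith) (by linarith)
  have htriple : |pvIntegral (Ω.lineY (z 1)) (z 0) (middleX Ω l ψ (z 0) (z 1))| ≤ _ :=
    (hoelder_numeratorX hψ hk (z 0)).abs_iteratedOuter_le (by norm_num) (by norm_num)
      h₁ h₁ h₂ hε0 (by linarith)
  refine (abs_data_rpow_le h₁ h₂ (by linarith) hN hP1 hw₁ hw₂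
    (indicator_one_mem Ω.region z) (fun h => (Set.mem_of_indicator_ne_zero (s := Ω.region) h).symm)
    (indicator_one_mem (Ω.lineY (z 1)) (z 0)) Set.mem_of_indicator_ne_zero
    hsingle (htriple.trans (le_of_eq (by ring)))).trans (le_of_eq (by ring))

theorem memLp_pyramidY (hD : 0 ≤ D) (hψ : PhaseHoelder ψ C) (hk : LipschitzKernels k l K)
    {p : ℝ≥0∞} (hp : 1 ≤ p) (hp' : p < ∞) : MemLp (pyramidY Ω k l ψ) p volume := by
  have hP1 : 1 ≤ p.toReal := by
    rw [← ENNReal.toReal_one]; exact ENNReal.toReal_mono hp'.ne hp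
  have hN : 0 ≤ numeratorBound C K := by
    have := hψ.1; have := hk.nonneg
    simp only [numeratorBound]; positivity
  set ε := 1 / (8 * p.toReal) with hε
  have hε0 : 0 < ε := by positivity
  have hε8 : ε ≤ 1 / 8 := by rw [hε]; gcongr; linarith
  have hint := Ω.integrable_weights integrable_one_add_abs_rpow (by fun_prop)
    (fun y => by positivity)
    (fun y => Real.rpow_le_one_of_one_le_of_nonpos (by linarith [abs_nonneg y]) (by norm_num))
    (integrable_indicator_Icc (D / 2)) (measurable_one.indicator measurableSet_Icc)
    (fun x => (indicator_one_mem _ x).1) (fun x => (indicator_one_mem _ x).2)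
  refine memLp_of_rpow_le hp hp' (aestronglyMeasurable_pyramidY hψ hk)
    (hint.const_mul (dataBound (numeratorBound C K) (D / 2) ε ^ p.toReal)) ?_
  filter_upwards [Ω.ae_offBorder] with z hz
  obtain ⟨d₁, h₁, hw₁⟩ := hz.exists_regular_lineX
  obtain ⟨d₂, h₂, hw₂⟩ := hz.exists_regular_lineY
  have hsingle := ((hoelder_singleY hψ hk (z 0) (z 1)).hoelderAt (by norm_num) _).abs_pvIntegral_le
    h₁ hε0 (by linarith) (by linarith)
  have htriple : |pvIntegral (Ω.lineY (z 1)) (z 0) (middleY Ω l ψ (z 0) (z 1))| ≤ _ :=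
    (hoelder_numeratorY hψ hk (z 1)).abs_iteratedOuter_le (by norm_num) (by norm_num)
      h₂ h₁ h₂ hε0 (by linarith)
  refine (abs_data_rpow_le h₂ h₁ (by linarith) hN hP1 hw₂ hw₁
    (indicator_one_mem Ω.region z) (fun h => Set.mem_of_indicator_ne_zero (s := Ω.region) h)
    (indicator_one_mem (Ω.lineX (z 0)) (z 1)) Set.mem_of_indicator_ne_zero
    hsingle (htriple.trans (le_of_eq (by ring)))).trans (le_of_eq (by ring))

end PyramidSensor

theorem mainTheorem2
    (D lam T : ℝ) (hD : 0 < D) (hlam : 0 < lam) (hT : 0 < T) (r : ℕ) (hr : 0 < r)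
    (Ω : PyramidSensor.Aperture D) (m : PyramidSensor.Modulation)
    (k : ℝ → ℝ) (hk : k = m.k (PyramidSensor.modulationParameter r lam D))
    (l : ℝ → ℝ → ℝ) (hl : l = m.l (PyramidSensor.modulationParameter r lam D) T)
    (Φ : Lp ℝ 2 (volume : Measure PyramidSensor.Plane)) (hΦ : Φ ∈ PyramidSensor.sobolevH (11 / 6))
    (φ : PyramidSensor.Plane → ℝ) (hφ : φ =ᵐ[volume] Φ) :
    -- all principal values exist almost everywhere
    (∀ᵐ z : PyramidSensor.Plane, PyramidSensor.PyramidXExists Ω k l φ z ∧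
      PyramidSensor.PyramidYExists Ω k l φ z) ∧
    -- the result does not depend on the representative of the class `Φ`
    (PyramidSensor.pyramidX Ω k l φ =ᵐ[volume] PyramidSensor.pyramidX Ω k l Φ ∧
      PyramidSensor.pyramidY Ω k l φ =ᵐ[volume] PyramidSensor.pyramidY Ω k l Φ) ∧
    -- the result lies in `L₂`
    (MemLp (PyramidSensor.pyramidX Ω k l φ) 2 volume ∧
      MemLp (PyramidSensor.pyramidY Ω k l φ) 2 volume) ∧
    -- the result lies in every `L_p`, `1 ≤ p < ∞`
    (∀ p : ℝ≥0∞, 1 ≤ p → p < ∞ →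
      MemLp (PyramidSensor.pyramidX Ω k l φ) p volume ∧
        MemLp (PyramidSensor.pyramidY Ω k l φ) p volume) := by
  obtain ⟨ψ, C, hC, hψ, hH⟩ := PyramidSensor.exists_hoelder_representative hΦ
  have hP : PyramidSensor.PhaseHoelder ψ C := ⟨hC, hH⟩
  have hK : PyramidSensor.LipschitzKernels k l
      |PyramidSensor.modulationParameter r lam D| := by
    rw [hk, hl]; exact m.lipschitzKernels hT
  have hφψ := PyramidSensor.ae_agreeAt (hφ.trans hψ)
  have hΦψ := PyramidSensor.ae_agreeAt hψ
  have hX : PyramidSensor.pyramidX Ω k l φ =ᵐ[volume] PyramidSensor.pyramidX Ω k l ψ :=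
    hφψ.mono fun z hz => hz.pyramidX_eq
  have hY : PyramidSensor.pyramidY Ω k l φ =ᵐ[volume] PyramidSensor.pyramidY Ω k l ψ :=
    hφψ.mono fun z hz => hz.pyramidY_eq
  have hLp : ∀ p : ℝ≥0∞, 1 ≤ p → p < ∞ →
      MemLp (PyramidSensor.pyramidX Ω k l φ) p volume ∧
        MemLp (PyramidSensor.pyramidY Ω k l φ) p volume := fun p hp hp' =>
    ⟨(memLp_congr_ae hX).2 (PyramidSensor.memLp_pyramidX hD.le hP hK hp hp'),
      (memLp_congr_ae hY).2 (PyramidSensor.memLp_pyramidY hD.le hP hK hp hp')⟩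
  refine ⟨?_, ⟨?_, ?_⟩, hLp 2 (by norm_num) (by norm_num), hLp⟩
  · filter_upwards [hφψ, Ω.ae_offBorder] with z hz hoff
    exact ⟨hz.pyramidXExists (PyramidSensor.pyramidXExists_of_phaseHoelder hP hK hoff),
      hz.pyramidYExists (PyramidSensor.pyramidYExists_of_phaseHoelder hP hK hoff)⟩
  · exact hX.trans (hΦψ.mono fun z hz => hz.pyramidX_eq.symm)
  · exact hY.trans (hΦψ.mono fun z hz => hz.pyramidY_eq.symm)
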